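/- **Definitions.** All categories below consist of small objects in one fixed universe. A *complete orthomodular lattice* is a complete lattice $P$ with an order-reversing involution $p\mapsto p^\perp$ such that $p\vee p^\perp=1$, $p\wedge p^\perp=0$, and $p\vee(p^\perp\wedge q)=q$ whenever $p\le q$. With functions preserving $\perp$ and arbitrary suprema as morphisms, these form the category $\mathbf{COML}$. A *piecewise complete Boolean algebra* is a set $B$ with a reflexive symmetric relation $\odot$ (commeasurability), a total operation $\neg\colon B\to B$, and an operation $\bigvee$ assigning an element of $B$ to each pairwise commeasurable subset of $B$, such that every pairwise commeasurable $S\subseteq B$ is contained in a *commeasurable subalgebra*, i.e. a pairwise commeasurable $T\subseteq B$ that is a complete Boolean algebra under these operations. Morphisms are functions preserving $\odot$, $\neg$ and $\bigvee$ (of pairwise commeasurable sets); this gives the category $\mathbf{PCBool}$. Let $\le$ be the union of the partial orders of all commeasurable subalgebras of $B$. Call $B$ *transitive* if $\le$ is transitive, and *joined* if every two (not necessarily commeasurable) elements of $B$ have a least upper bound (binary join) with respect to $\le$. An *AW\*-algebra* is a unital C\*-algebra in which the right annihilator of every subset is generated as a right ideal by a projection. A *piecewise C\*-algebra* is a set $A$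 with a reflexive symmetric relation $\odot$, elements $0,1$, total operations ${}^*\colon A\to A$, $\mathbb C\times A\to A$ and $\|\cdot\|\colon A\to\mathbb R$, and sums and products defined on commeasurable pairs, such that every pairwise commeasurable $S\subseteq A$ is contained in a pairwise commeasurable $T\subseteq A$ that is a commutative C\*-algebra (with unit $1$) under these operations. Its projections are $\mathrm{Proj}(A)=\{p\in A: p^*=p=p^2\}$. A *piecewise AW\*-algebra* is a piecewise C\*-algebra $A$ with a function $\mathrm{RP}\colon A\to\mathrm{Proj}(A)$ and an operation $\bigvee$ assigning a projection to each pairwise commeasurable set of projections, such that to every pairwise commeasurable $S\subseteq A$ one can assign a pairwise commeasurable $T(S)\supseteq S$ that is a commutative AW\*-algebra under these operations (with $\mathrm{RP}$ giving right supporting projections and $\bigvee$ giving suprema of projections in $T(S)$), coherently: $S\subseteq S'$ implies $T(S)\subseteq T(S')$. A morphism is a function $f$ that preserves $\odot$, sums and products of commeasurable elements, scalar multiplication, ${}^*$, $1$, and $\bigvee$ of pairwise commeasurable sets of projections. This gives the category $\mathbf{PAW^*}$. The set $\mathrm{Proj}(A)$, with the relation $\odot$, $\neg p=1-p$ and $\bigvee$,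 is a piecewise complete Boolean algebra, and $A$ is called *transitive* (*joined*) if $\mathrm{Proj}(A)$ is. **Proposition.** The following three categories are equivalent: (a) the category $\mathbf{COML}$ of complete orthomodular lattices; (b) the subcategory of $\mathbf{PCBool}$ whose objects are transitive and joined, and whose morphisms preserve binary joins; (c) the subcategory of $\mathbf{PAW^*}$ whose objects are transitive and joined, and whose morphisms preserve binary joins of projections. -/

import Mathlib

open CategoryTheory

universe u

/-! # Complete orthomodular lattices -/

/-- A complete orthomodular lattice: a complete lattice with an order-reversing involution
sending each element to a complement, satisfying the orthomodular law. -/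
class CompleteOrthomodularLattice (P : Type u) extends CompleteLattice P, Compl P where
  compl_anti : ∀ p q : P, p ≤ q → qᶜ ≤ pᶜ
  compl_invol : ∀ p : P, pᶜᶜ = p
  sup_compl : ∀ p : P, p ⊔ pᶜ = ⊤
  inf_compl : ∀ p : P, p ⊓ pᶜ = ⊥
  orthomodular : ∀ p q : P, p ≤ q → p ⊔ (pᶜ ⊓ q) = q

/-- Functions preserving orthocomplements and arbitrary suprema. -/
@[ext]
structure COMLHom (P Q : Type u) [CompleteOrthomodularLattice P]
    [CompleteOrthomodularLattice Q] where
  toFun : P → Q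
  map_compl : ∀ p, toFun pᶜ = (toFun p)ᶜ
  map_sSup : ∀ X : Set P, toFun (sSup X) = sSup (toFun '' X)

/-- Objects of the category of complete orthomodular lattices. -/
structure COML : Type (u + 1) where
  carrier : Type u
  [inst : CompleteOrthomodularLattice carrier]

attribute [instance] COML.inst

instance : Category.{u} COML.{u} where
  Hom P Q := COMLHom P.carrier Q.carrier
  id P :=
    { toFun := fun p => p
      map_compl := fun _ => rfl
      map_sSup := fun X => by rw [Set.image_id'] }
  comp f g :=
    { toFun := fun p => g.toFun (f.toFun p)
      map_compl := fun p => by rw [f.map_compl, g.map_compl]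
      map_sSup := fun X => by rw [f.map_sSup, g.map_sSup, Set.image_image] }

/-! # Piecewise complete Boolean algebras -/

/-- All elements of `X` are pairwise related by `r`. -/
def PairwiseRel {B : Type u} (r : B → B → Prop) (X : Set B) : Prop :=
  ∀ x ∈ X, ∀ y ∈ X, r x y

theorem PairwiseRel.image {B C : Type u} {r : B → B → Prop} {s : C → C → Prop} {f : B → C}
    (hf : ∀ x y, r x y → s (f x) (f y)) {X : Set B} (hX : PairwiseRel r X) :
    PairwiseRel s (f '' X) := by
  rintro _ ⟨x, hx, rfl⟩ _ ⟨y, hy, rfl⟩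
  exact hf x y (hX x hx y hy)

/-- The data of a piecewise complete Boolean algebra: a reflexive symmetric commeasurability
relation, a total negation, and suprema of pairwise commeasurable sets. -/
class PCBData (B : Type u) where
  comm : B → B → Prop
  comm_refl : ∀ x, comm x x
  comm_symm : ∀ x y, comm x y → comm y x
  neg : B → B
  sup : (X : Set B) → PairwiseRel comm X → B

/-- The structure of a commeasurable subalgebra on `T`: the elements of `T` are pairwise
commeasurable, and `T` is a complete Boolean algebra under the operations of `B`
(in particular, `T` is closed under these operations). -/
structure CommeasurableSubalgebra {B : Type u} [PCBData B] (T : Set B) where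
  pairwise_comm : PairwiseRel PCBData.comm T
  alg : CompleteBooleanAlgebra T
  coe_compl : ∀ x : T, ((xᶜ : T) : B) = PCBData.neg (x : B)
  coe_sSup : ∀ (X : Set T) (hX : PairwiseRel PCBData.comm (Subtype.val '' X)),
    ((sSup X : T) : B) = PCBData.sup (Subtype.val '' X) hX

/-- A piecewise complete Boolean algebra. -/
class PiecewiseCBA (B : Type u) extends PCBData B where
  exists_subalgebra : ∀ S : Set B, PairwiseRel comm S →
    ∃ T : Set B, S ⊆ T ∧ Nonempty (CommeasurableSubalgebra T)

section Order

variable {B C : Type u} [PCBData B] [PCBData C]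

/-- The union of the partial orders on the commeasurable subalgebras. -/
def inducedLE (x y : B) : Prop :=
  ∃ (T : Set B) (A : CommeasurableSubalgebra T) (hx : x ∈ T) (hy : y ∈ T),
    A.alg.le ⟨x, hx⟩ ⟨y, hy⟩

/-- `j` is a least upper bound of `x` and `y` for the induced relation. -/
def IsBinaryJoin (x y j : B) : Prop :=
  inducedLE x j ∧ inducedLE y j ∧ ∀ z, inducedLE x z → inducedLE y z → inducedLE j z

variable (B) in
/-- The induced relation is transitive. -/
def IsTransitivePCB : Prop :=
  ∀ x y z : B, inducedLE x y → inducedLE y z → inducedLE x z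

variable (B) in
/-- Every two (not necessarily commeasurable) elements have a least upper bound. -/
def IsJoinedPCB : Prop :=
  ∀ x y : B, ∃ j, IsBinaryJoin x y j

/-- The function `f` preserves binary joins. -/
def PreservesBinaryJoins (f : B → C) : Prop :=
  ∀ x y j : B, IsBinaryJoin x y j → IsBinaryJoin (f x) (f y) (f j)

end Order

/-- Morphisms of piecewise complete Boolean algebras. -/
@[ext]
structure PCBHom (B C : Type u) [PCBData B] [PCBData C] where
  toFun : B → C
  map_comm : ∀ x y, PCBData.comm x y → PCBData.comm (toFun x) (toFun y)
  map_neg : ∀ x, toFun (PCBData.neg x) = PCBData.neg (toFun x)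
  map_sup : ∀ (X : Set B) (hX : PairwiseRel PCBData.comm X),
    toFun (PCBData.sup X hX) = PCBData.sup (toFun '' X) (hX.image map_comm)

/-- Objects of the category of piecewise complete Boolean algebras. -/
structure PCBoolean : Type (u + 1) where
  carrier : Type u
  [inst : PiecewiseCBA carrier]

attribute [instance] PCBoolean.inst

instance : Category.{u} PCBoolean.{u} where
  Hom B C := PCBHom B.carrier C.carrier
  id B :=
    { toFun := fun x => x
      map_comm := fun _ _ h => h
      map_neg := fun _ => rfl
      map_sup := fun X hX => by congr 1; simp }
  comp f g :=
    { toFun := fun x => g.toFun (f.toFun x)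
      map_comm := fun x y h => g.map_comm _ _ (f.map_comm x y h)
      map_neg := fun x => by rw [f.map_neg, g.map_neg]
      map_sup := fun X hX => by
        rw [f.map_sup, g.map_sup]
        congr 1
        rw [Set.image_image] }

/-- Transitive, joined piecewise complete Boolean algebras. -/
structure TJPCBoolean : Type (u + 1) where
  obj : PCBoolean.{u}
  transitive : IsTransitivePCB obj.carrier
  joined : IsJoinedPCB obj.carrier

/-- The morphisms are those of `PCBoolean` that preserve binary joins. -/
instance : Category.{u} TJPCBoolean.{u} where
  Hom B C := {f : B.obj ⟶ C.obj // PreservesBinaryJoins (PCBHom.toFun f)}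
  id B := ⟨𝟙 B.obj, fun _ _ _ h => h⟩
  comp f g := ⟨f.1 ≫ g.1, fun x y j h => g.2 _ _ _ (f.2 x y j h)⟩
  id_comp f := Subtype.ext (Category.id_comp f.1)
  comp_id f := Subtype.ext (Category.comp_id f.1)
  assoc f g h := Subtype.ext (Category.assoc f.1 g.1 h.1)

/-! # Piecewise AW*-algebras -/

/-- A C*-algebra is an AW*-algebra when the right annihilator of each subset is generated, as a
right ideal, by a projection. -/
def IsAWStarAlgebra (A : Type u) [CStarAlgebra A] : Prop :=
  ∀ S : Set A, ∃ p : A, IsStarProjection p ∧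
    {y : A | ∀ x ∈ S, x * y = 0} = {y : A | ∃ z : A, y = p * z}

/-- The data of a piecewise C*-algebra; sums and products are defined only for commeasurable
elements. -/
class PCStarData (A : Type u) where
  comm : A → A → Prop
  comm_refl : ∀ a, comm a a
  comm_symm : ∀ a b, comm a b → comm b a
  zero : A
  one : A
  star : A → A
  smul : ℂ → A → A
  norm : A → ℝ
  add : (a b : A) → comm a b → A
  mul : (a b : A) → comm a b → A

/-- The elements of `T` are pairwise commeasurable, and `T` is a commutative C*-algebra under the
operations of `A` (in particular, `T` is closed under these operations). -/
structure CommeasurableCStarSubalgebra {A : Type u} [PCStarData A] (T : Set A) where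
  pairwise_comm : PairwiseRel PCStarData.comm T
  alg : CommCStarAlgebra T
  coe_zero : ((0 : T) : A) = PCStarData.zero
  coe_one : ((1 : T) : A) = PCStarData.one
  coe_star : ∀ a : T, ((star a : T) : A) = PCStarData.star (a : A)
  coe_smul : ∀ (z : ℂ) (a : T), ((z • a : T) : A) = PCStarData.smul z (a : A)
  coe_norm : ∀ a : T, ‖a‖ = PCStarData.norm (a : A)
  coe_add : ∀ (a b : T) (h : PCStarData.comm (a : A) (b : A)),
    ((a + b : T) : A) = PCStarData.add (a : A) (b : A) h
  coe_mul : ∀ (a b : T) (h : PCStarData.comm (a : A) (b : A)),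
    ((a * b : T) : A) = PCStarData.mul (a : A) (b : A) h

/-- A piecewise C*-algebra. -/
class PiecewiseCStarAlgebra (A : Type u) extends PCStarData A where
  exists_subalgebra : ∀ S : Set A, PairwiseRel comm S →
    ∃ T : Set A, S ⊆ T ∧ Nonempty (CommeasurableCStarSubalgebra T)

/-- The projections: elements `p` with `p* = p = p²`. -/
def PProj (A : Type u) [PCStarData A] : Type u :=
  {p : A // PCStarData.star p = p ∧ PCStarData.mul p p (PCStarData.comm_refl p) = p}

/-- Commeasurability of projections. -/
def PProj.comm {A : Type u} [PCStarData A] (p q : PProj A) : Prop :=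
  PCStarData.comm p.1 q.1

/-- The data of a piecewise AW*-algebra: right supporting projections, and suprema of
pairwise commeasurable sets of projections. -/
class PAWStarData (A : Type u) extends PiecewiseCStarAlgebra A where
  rp : A → PProj A
  sup : (X : Set (PProj A)) → PairwiseRel PProj.comm X → PProj A

/-- The elements of `T` are pairwise commeasurable, and `T` is a commutative AW*-algebra under the
operations of `A`, including right supporting projections and suprema of projections. -/
structure CommeasurableAWStarSubalgebra {A : Type u} [PAWStarData A] (T : Set A) extends
    CommeasurableCStarSubalgebra T where
  isAWStar : IsAWStarAlgebra T
  /-- `rp a` lies in `T` and is the least projection `p` of `T` with `a p = a`. -/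
  rp_spec : ∀ a : T, ∃ p : T, (p : A) = (PAWStarData.rp (a : A)).1 ∧
    IsStarProjection p ∧ a * p = a ∧ ∀ q : T, IsStarProjection q → a * q = a → p = p * q
  /-- For a set `X` of projections of `T`, `sup X` lies in `T` and is the supremum of `X` among the
  projections of `T`, ordered by `p ≤ q ↔ p = p q`. -/
  sup_spec : ∀ (X : Set (PProj A)) (hX : PairwiseRel PProj.comm X), (∀ p ∈ X, p.1 ∈ T) →
    ∃ s : T, (s : A) = (PAWStarData.sup X hX).1 ∧ IsStarProjection s ∧
      (∀ p : T, (∃ x ∈ X, x.1 = (p : A)) → p = p * s) ∧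
      ∀ q : T, IsStarProjection q →
        (∀ p : T, (∃ x ∈ X, x.1 = (p : A)) → p = p * q) → s = s * q

/-- A piecewise AW*-algebra: each pairwise commeasurable set `S` is contained in a commeasurable
commutative AW*-algebra `T S`, and these can be chosen coherently, that is, monotonically in `S`.
Without coherence, one could glue two copies of an infinite-dimensional commutative AW*-algebra
along the linear span of its projections, and the projections would not determine the result. -/
class PiecewiseAWStarAlgebra (A : Type u) extends PAWStarData A where
  exists_subalgebra_mono : ∃ T : (S : Set A) → PairwiseRel PCStarData.comm S → Set A,
    (∀ S hS, S ⊆ T S hS) ∧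
    (∀ S hS, Nonempty (CommeasurableAWStarSubalgebra (T S hS))) ∧
    ∀ S hS S' hS', S ⊆ S' → T S hS ⊆ T S' hS'

section Projections

variable {A : Type u}

theorem PiecewiseCStarAlgebra.exists_mem [PiecewiseCStarAlgebra A] (a : A) :
    ∃ T : Set A, a ∈ T ∧ Nonempty (CommeasurableCStarSubalgebra T) := by
  obtain ⟨T, hT, h⟩ := PiecewiseCStarAlgebra.exists_subalgebra ({a} : Set A) (by
    rintro x rfl y rfl
    exact PCStarData.comm_refl _)
  exact ⟨T, hT rfl, h⟩

theorem PiecewiseCStarAlgebra.comm_one_neg [PiecewiseCStarAlgebra A] (a : A) :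
    PCStarData.comm (PCStarData.one : A) (PCStarData.smul (-1) a) := by
  obtain ⟨T, ha, ⟨h⟩⟩ := PiecewiseCStarAlgebra.exists_mem a
  let _ := h.alg
  rw [← h.coe_one, ← h.coe_smul (-1) ⟨a, ha⟩]
  exact h.pairwise_comm _ (Subtype.prop _) _ (Subtype.prop _)

/-- The element `1 - a`. -/
def PiecewiseCStarAlgebra.oneSub [PiecewiseCStarAlgebra A] (a : A) : A :=
  PCStarData.add PCStarData.one (PCStarData.smul (-1) a)
    (PiecewiseCStarAlgebra.comm_one_neg a)

theorem CommeasurableCStarSubalgebra.coe_oneSub [PiecewiseCStarAlgebra A] {T : Set A}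
    (h : CommeasurableCStarSubalgebra T) (a : T) :
    letI := h.alg
    ((1 - a : T) : A) = PiecewiseCStarAlgebra.oneSub (a : A) := by
  let _ := h.alg
  have e : (1 - a : T) = 1 + (-1 : ℂ) • a := by rw [neg_one_smul, sub_eq_add_neg]
  change ((1 - a : T) : A) = _
  rw [e, h.coe_add _ _ (h.pairwise_comm _ (Subtype.prop _) _ (Subtype.prop _))]
  unfold PiecewiseCStarAlgebra.oneSub
  congr 1
  · exact h.coe_one
  · exact h.coe_smul _ _

/-- The projection `1 - p`. -/
def PProj.neg [PiecewiseCStarAlgebra A] (p : PProj A) : PProj A :=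
  ⟨PiecewiseCStarAlgebra.oneSub p.1, by
    obtain ⟨T, ha, ⟨h⟩⟩ := PiecewiseCStarAlgebra.exists_mem p.1
    let _ := h.alg
    let a : T := ⟨p.1, ha⟩
    have hs : star a = a := Subtype.ext ((h.coe_star a).trans p.2.1)
    have hm : a * a = a :=
      Subtype.ext ((h.coe_mul a a (PCStarData.comm_refl _)).trans p.2.2)
    have e : ((1 - a : T) : A) = PiecewiseCStarAlgebra.oneSub p.1 := h.coe_oneSub a
    constructor
    · rw [← e, ← h.coe_star, star_sub, star_one, hs]
    · have e2 := h.coe_mul (1 - a) (1 - a) (PCStarData.comm_refl _)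
      have e3 : (1 - a) * (1 - a) = 1 - a := by
        rw [sub_mul, one_mul, mul_sub, mul_one, hm, sub_self, sub_zero]
      rw [e3] at e2
      simp only [e] at e2
      exact e2.symm⟩

/-- The projections of a piecewise AW*-algebra, with the operations of a piecewise
complete Boolean algebra. -/
instance [PAWStarData A] : PCBData (PProj A) where
  comm := PProj.comm
  comm_refl p := PCStarData.comm_refl p.1
  comm_symm p q h := PCStarData.comm_symm p.1 q.1 h
  neg := PProj.neg
  sup := PAWStarData.sup

end Projections

/-- The algebraic part of the notion of a morphism of piecewise AW*-algebras. -/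
@[ext]
structure PCStarHom (A B : Type u) [PCStarData A] [PCStarData B] where
  toFun : A → B
  map_comm : ∀ a b, PCStarData.comm a b → PCStarData.comm (toFun a) (toFun b)
  map_one : toFun PCStarData.one = PCStarData.one
  map_mul : ∀ a b (h : PCStarData.comm a b),
    toFun (PCStarData.mul a b h) = PCStarData.mul (toFun a) (toFun b) (map_comm a b h)
  map_add : ∀ a b (h : PCStarData.comm a b),
    toFun (PCStarData.add a b h) = PCStarData.add (toFun a) (toFun b) (map_comm a b h)
  map_smul : ∀ (z : ℂ) (a : A), toFun (PCStarData.smul z a) = PCStarData.smul z (toFun a)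
  map_star : ∀ a, toFun (PCStarData.star a) = PCStarData.star (toFun a)

/-- The restriction of a morphism to projections. -/
def PCStarHom.onProj {A B : Type u} [PCStarData A] [PCStarData B] (f : PCStarHom A B)
    (p : PProj A) : PProj B :=
  ⟨f.toFun p.1, by rw [← f.map_star, p.2.1], by
    rw [← f.map_mul p.1 p.1 (PCStarData.comm_refl p.1), p.2.2]⟩

theorem PCStarHom.onProj_comm {A B : Type u} [PCStarData A] [PCStarData B] (f : PCStarHom A B)
    (p q : PProj A) (h : PProj.comm p q) : PProj.comm (f.onProj p) (f.onProj q) :=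
  f.map_comm p.1 q.1 h

/-- Morphisms of piecewise AW*-algebras. -/
@[ext]
structure PAWStarHom (A B : Type u) [PAWStarData A] [PAWStarData B] extends PCStarHom A B where
  map_sup : ∀ (X : Set (PProj A)) (hX : PairwiseRel PProj.comm X),
    toPCStarHom.onProj (PAWStarData.sup X hX) =
      PAWStarData.sup (toPCStarHom.onProj '' X) (hX.image toPCStarHom.onProj_comm)

/-- Objects of the category of piecewise AW*-algebras. -/
structure PAWStar : Type (u + 1) where
  carrier : Type u
  [inst : PiecewiseAWStarAlgebra carrier]

attribute [instance] PAWStar.inst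

/-- The identity, algebraically. -/
def PCStarHom.id (A : Type u) [PCStarData A] : PCStarHom A A where
  toFun a := a
  map_comm _ _ h := h
  map_one := rfl
  map_mul _ _ _ := rfl
  map_add _ _ _ := rfl
  map_smul _ _ := rfl
  map_star _ := rfl

/-- Composition, algebraically. -/
def PCStarHom.comp {A B C : Type u} [PCStarData A] [PCStarData B] [PCStarData C]
    (g : PCStarHom B C) (f : PCStarHom A B) : PCStarHom A C where
  toFun a := g.toFun (f.toFun a)
  map_comm a b h := g.map_comm _ _ (f.map_comm a b h)
  map_one := by rw [f.map_one, g.map_one]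
  map_mul a b h := by rw [f.map_mul a b h, g.map_mul]
  map_add a b h := by rw [f.map_add a b h, g.map_add]
  map_smul z a := by rw [f.map_smul, g.map_smul]
  map_star a := by rw [f.map_star, g.map_star]

instance : Category.{u} PAWStar.{u} where
  Hom A B := PAWStarHom A.carrier B.carrier
  id A :=
    { PCStarHom.id A.carrier with
      map_sup := fun X hX => by
        change PAWStarData.sup X hX = _
        congr 1
        exact (Set.image_id X).symm }
  comp f g :=
    { g.toPCStarHom.comp f.toPCStarHom with
      map_sup := fun X hX => by
        change g.toPCStarHom.onProj (f.toPCStarHom.onProj (PAWStarData.sup X hX)) = _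
        rw [f.map_sup, g.map_sup]
        congr 1
        exact Set.image_image _ _ _ }

/-- Transitive, joined piecewise AW*-algebras: those whose projections are so. -/
structure TJPAWStar : Type (u + 1) where
  obj : PAWStar.{u}
  transitive : IsTransitivePCB (PProj obj.carrier)
  joined : IsJoinedPCB (PProj obj.carrier)

/-- The morphisms are those of `PAWStar` that preserve binary joins of projections. -/
instance : Category.{u} TJPAWStar.{u} where
  Hom A B := {f : A.obj ⟶ B.obj // PreservesBinaryJoins (PAWStarHom.toPCStarHom f).onProj}
  id A := ⟨𝟙 A.obj, fun _ _ _ h => h⟩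
  comp f g := ⟨f.1 ≫ g.1, fun x y j h => g.2 _ _ _ (f.2 x y j h)⟩
  id_comp f := Subtype.ext (Category.id_comp f.1)
  comp_id f := Subtype.ext (Category.comp_id f.1)
  assoc f g h := Subtype.ext (Category.assoc f.1 g.1 h.1)

/-! Both equivalences pass through piecewise Boolean algebras: `comlToTJPCBoolean` and `projFunctor`
are shown to be full, faithful and essentially surjective.

Lattices. Call elements of an orthomodular lattice commeasurable when they commute. By the
Foulis–Holland theorem (`inf_sSup_of_commutes`) the bicommutant of a commuting set is a complete
Boolean algebra, so the lattice is a piecewise one, with the same order. Conversely, in a transitive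
joined algebra chains are commeasurable and so have suprema; with binary joins, Zorn's lemma
(`exists_isGreatest_of_chain_closed`) yields all suprema. The orthomodular laws involve only
commeasurable elements and hold in a Boolean subalgebra. Commeasurability is recovered as
commutation (`comm_iff_commutes`), because commuting elements are joins of orthogonal pieces. The
same use of Zorn's lemma shows that a morphism preserving binary joins and suprema of commuting sets
preserves all suprema.

Algebras. By Gelfand duality and Stone–Weierstrass a commutative AW*-algebra is the closed star
subalgebra generated by its projections, so homomorphisms out of it are determined by projections,
and Boolean homomorphisms of projections extend (`IsAWStarAlgebra.exists_extension`). Coherence of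
the chosen subalgebras glues these extensions, making `projFunctor` fully faithful. For essential
surjectivity, the continuous functions on the Stone spaces of all Boolean subsets `R` of a lattice
are to be glued along inclusions `R ⊆ R'`. Instead of a quotient, a function is encoded by its
spectral family in the lattice, which determines it, does not depend on `R` (`spec_comp_res`), and
detects descent to a smaller `R` (`exists_comp_res`). Completeness of `R` makes its Stone space
extremally disconnected, hence the functions an AW*-algebra, whose projections are the indicators of
elements of `R`. -/

/-! # Commutation in complete orthomodular lattices -/

/-- A partial order with suprema of all subsets is a complete Boolean algebra as soon as it has
complements and binary infima distribute over suprema, expressed in terms of the order. -/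
@[reducible] def completeBooleanAlgebraOfSup (T : Type u) [PartialOrder T] [SupSet T] [Compl T]
    (hlub : ∀ s : Set T, IsLUB s (sSup s))
    (hinf : ∀ x z : T, z ≤ x → z ≤ xᶜ → ∀ w, z ≤ w)
    (hsup : ∀ x z : T, x ≤ z → xᶜ ≤ z → ∀ w, w ≤ z)
    (hdist : ∀ (s : Set T) (x u : T), (∀ y ∈ s, ∀ z ≤ x, z ≤ y → z ≤ u) →
      ∀ z ≤ x, z ≤ sSup s → z ≤ u) : CompleteBooleanAlgebra T :=
  -- The hypotheses speak only of bounds, so they make sense before meets exist. The given suprema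
  -- and complements are kept definitionally.
  letI : CompleteLattice T := completeLatticeOfSup T hlub
  { __ := DistribLattice.ofInfSupLe fun a b c => by
      refine hdist {b, c} a _ ?_ _ inf_le_left (inf_le_right.trans (sup_le ?_ ?_))
      · rintro y (rfl | rfl) z h1 h2
        · exact (le_inf h1 h2).trans le_sup_left
        · exact (le_inf h1 h2).trans le_sup_right
      · exact (hlub _).1 (by simp)
      · exact (hlub _).1 (by simp)
    __ := (inferInstance : CompleteLattice T)
    compl := fun x => xᶜ
    sdiff := fun x y => x ⊓ yᶜ
    himp := fun x y => y ⊔ xᶜ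
    sdiff_eq := fun _ _ => rfl
    himp_eq := fun _ _ => rfl
    inf_compl_le_bot := fun x => hinf x _ inf_le_left inf_le_right _
    top_le_sup_compl := fun x => hsup x _ le_sup_left le_sup_right _ }

namespace CompleteOrthomodularLattice

variable {P : Type u} [CompleteOrthomodularLattice P]

theorem compl_le_compl {p q : P} (h : p ≤ q) : qᶜ ≤ pᶜ := compl_anti p q h

theorem le_compl_comm {p q : P} (h : p ≤ qᶜ) : q ≤ pᶜ := by
  simpa [compl_invol] using compl_le_compl h

theorem compl_sSup (X : Set P) : (sSup X)ᶜ = ⨅ x ∈ X, xᶜ := by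
  apply le_antisymm
  · exact le_iInf₂ fun x hx => compl_le_compl (le_sSup hx)
  · refine le_compl_comm (sSup_le fun x hx => le_compl_comm ?_)
    exact iInf₂_le x hx

theorem compl_sup (p q : P) : (p ⊔ q)ᶜ = pᶜ ⊓ qᶜ := by
  rw [← sSup_pair, compl_sSup, iInf_pair]

theorem compl_inf (p q : P) : (p ⊓ q)ᶜ = pᶜ ⊔ qᶜ := by
  rw [← compl_invol (pᶜ ⊔ qᶜ), compl_sup, compl_invol, compl_invol]

theorem compl_bot : (⊥ : P)ᶜ = ⊤ := by
  rw [← sup_compl (⊥ : P), bot_sup_eq]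

/-- Commutation of two elements of an orthomodular lattice. -/
def Commutes (p q : P) : Prop := p = (p ⊓ q) ⊔ (p ⊓ qᶜ)

theorem commutes_of_le_sup {p q : P} (h : p ≤ (p ⊓ q) ⊔ (p ⊓ qᶜ)) : Commutes p q :=
  le_antisymm h (sup_le inf_le_left inf_le_left)

theorem Commutes.compl_right {p q : P} (h : Commutes p q) : Commutes p qᶜ := by
  unfold Commutes at *
  rwa [compl_invol, sup_comm]

/-- De Morgan turns commutation into `pᶜ = (pᶜ ⊔ qᶜ) ⊓ (pᶜ ⊔ q)`, and `q` lies below the second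
factor. Symmetry of commutation and the Foulis–Holland theorem both rest on this inequality. -/
theorem Commutes.sup_compl_inf_le {p q : P} (h : Commutes p q) : (pᶜ ⊔ qᶜ) ⊓ q ≤ pᶜ := by
  have : pᶜ = (pᶜ ⊔ qᶜ) ⊓ (pᶜ ⊔ q) := by
    conv_lhs => rw [h, compl_sup, compl_inf, compl_inf, compl_invol]
  conv_rhs => rw [this]
  exact inf_le_inf_left _ le_sup_right

/-- The orthomodular law for `p ⊓ q ≤ q` splits `q` into `p ⊓ q` and a remainder, which lies below
`pᶜ` by the previous inequality. -/
theorem Commutes.symm {p q : P} (h : Commutes p q) : Commutes q p := by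
  apply commutes_of_le_sup
  conv_lhs => rw [← orthomodular (p ⊓ q) q inf_le_right]
  rw [compl_inf]
  refine sup_le (le_sup_of_le_left (by rw [inf_comm])) (le_sup_of_le_right ?_)
  exact le_inf inf_le_right h.sup_compl_inf_le

theorem commutes_refl (p : P) : Commutes p p := by
  apply commutes_of_le_sup; simp

theorem commutes_of_le {p q : P} (h : p ≤ q) : Commutes p q :=
  commutes_of_le_sup (by rw [inf_eq_left.2 h]; exact le_sup_left)

/-- Commutation amounts to `q ≤ (q ⊓ p) ⊔ (q ⊓ pᶜ)`, whose right side is monotone in `q`. -/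
theorem Commutes.sSup_left {X : Set P} {p : P} (h : ∀ q ∈ X, Commutes q p) :
    Commutes (sSup X) p := by
  refine commutes_of_le_sup (sSup_le fun q hq => ?_)
  conv_lhs => rw [h q hq]
  exact sup_le_sup (inf_le_inf_right _ (le_sSup hq)) (inf_le_inf_right _ (le_sSup hq))

/-- The Foulis–Holland theorem. -/
theorem inf_sSup_of_commutes {x : P} {X : Set P} (h : ∀ y ∈ X, Commutes x y) :
    x ⊓ sSup X = ⨆ y ∈ X, x ⊓ y := by
  set s := ⨆ y ∈ X, x ⊓ y with hs
  have hst : s ≤ x ⊓ sSup X :=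
    iSup₂_le fun y hy => inf_le_inf_left _ (le_sSup hy)
  -- The part of `x` below `sᶜ` is orthogonal to each `y`: since `x ⊓ y ≤ s`, it lies below `(yᶜ ⊔
  -- xᶜ) ⊓ x`, which commutation of `y` with `x` puts below `yᶜ`.
  have key : sᶜ ⊓ x ≤ (sSup X)ᶜ := by
    rw [compl_sSup]
    refine le_iInf₂ fun y hy => ?_
    have h1 : sᶜ ≤ yᶜ ⊔ xᶜ := by
      rw [sup_comm, ← compl_inf]
      exact compl_le_compl (le_iSup₂_of_le y hy le_rfl)
    exact (inf_le_inf_right _ h1).trans (h y hy).symm.sup_compl_inf_le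
  -- The orthomodular remainder of `s` in `x ⊓ sSup X` lies below both `sSup X` and its complement,
  -- hence is `⊥`.
  rw [← orthomodular s _ hst]
  refine sup_eq_left.2 (le_trans ?_ bot_le)
  rw [← inf_compl (sSup X)]
  refine le_inf (inf_le_right.trans inf_le_right) (le_trans ?_ key)
  exact inf_le_inf_left _ inf_le_left

/-- If `p` and `q` commute and have no common lower bound, then they are orthogonal. -/
theorem Commutes.le_compl {p q : P} (h : Commutes p q) (h0 : p ⊓ q = ⊥) : p ≤ qᶜ := by
  rw [h, h0, bot_sup_eq]
  exact inf_le_right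

/-- The elements commuting with all elements of `S`. -/
def commutant (S : Set P) : Set P := {p | ∀ q ∈ S, Commutes p q}

theorem commutant_anti {S S' : Set P} (h : S ⊆ S') : commutant S' ⊆ commutant S :=
  fun _ hp _ hq => hp _ (h hq)

theorem subset_bicommutant (S : Set P) : S ⊆ commutant (commutant S) :=
  fun _ hp _ hq => (hq _ hp).symm

theorem commutant_tricommutant (S : Set P) :
    commutant (commutant (commutant S)) = commutant S :=
  (commutant_anti (subset_bicommutant S)).antisymm (subset_bicommutant _)

theorem compl_mem_commutant {S : Set P} {p : P} (h : p ∈ commutant S) : pᶜ ∈ commutant S :=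
  fun q hq => (h q hq).symm.compl_right.symm

theorem sSup_mem_commutant {S X : Set P} (h : X ⊆ commutant S) : sSup X ∈ commutant S :=
  fun q hq => Commutes.sSup_left fun _ hx => h hx q hq

/-- A set of pairwise commuting elements which equals its bicommutant. -/
structure IsBooleanSubset (R : Set P) : Prop where
  commutes : ∀ p ∈ R, ∀ q ∈ R, Commutes p q
  bicommutant_subset : commutant (commutant R) ⊆ R

/-- A commuting set lies in its commutant; taking commutants, the bicommutant lies in the commutant,
so its elements commute with one another. -/
theorem isBooleanSubset_bicommutant {S : Set P} (h : ∀ p ∈ S, ∀ q ∈ S, Commutes p q) :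
    IsBooleanSubset (commutant (commutant S)) where
  commutes _ hp q hq := hp q (commutant_anti (show S ⊆ commutant S from h) hq)
  bicommutant_subset := by rw [commutant_tricommutant]

namespace IsBooleanSubset

variable {R : Set P} (hR : IsBooleanSubset R)
include hR

theorem eq_bicommutant : commutant (commutant R) = R :=
  hR.bicommutant_subset.antisymm (subset_bicommutant R)

theorem compl_mem {p : P} (h : p ∈ R) : pᶜ ∈ R := by
  rw [← hR.eq_bicommutant] at *; exact compl_mem_commutant h

theorem sSup_mem {X : Set P} (h : X ⊆ R) : sSup X ∈ R := by
  rw [← hR.eq_bicommutant] at *; exact sSup_mem_commutant h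

theorem sup_mem {p q : P} (hp : p ∈ R) (hq : q ∈ R) : p ⊔ q ∈ R := by
  rw [← sSup_pair]; exact hR.sSup_mem (by rintro _ (rfl | rfl) <;> assumption)

theorem inf_mem {p q : P} (hp : p ∈ R) (hq : q ∈ R) : p ⊓ q ∈ R := by
  rw [← compl_invol (p ⊓ q), compl_inf]
  exact hR.compl_mem (hR.sup_mem (hR.compl_mem hp) (hR.compl_mem hq))

theorem bot_mem : (⊥ : P) ∈ R := by
  rw [← sSup_empty]; exact hR.sSup_mem (Set.empty_subset _)

theorem top_mem : (⊤ : P) ∈ R := by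
  rw [← compl_bot]; exact hR.compl_mem hR.bot_mem

/-- The complete Boolean algebra on a Boolean subset. -/
@[reducible] def completeBooleanAlgebra : CompleteBooleanAlgebra R :=
  letI : SupSet R := ⟨fun X => ⟨sSup (Subtype.val '' X), hR.sSup_mem (by simp)⟩⟩
  letI : Compl R := ⟨fun p => ⟨p.1ᶜ, hR.compl_mem p.2⟩⟩
  completeBooleanAlgebraOfSup R
    (fun s => ⟨fun x hx => le_sSup (a := x.1) ⟨x, hx, rfl⟩,
      fun z hz => sSup_le (by rintro _ ⟨x, hx, rfl⟩; exact hz hx)⟩)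
    (fun x z h1 h2 _ => by
      have : z.1 ≤ x.1 ⊓ x.1ᶜ := le_inf h1 h2
      rw [inf_compl] at this
      exact this.trans bot_le)
    (fun x z h1 h2 w => by
      have : x.1 ⊔ x.1ᶜ ≤ z.1 := sup_le h1 h2
      rw [sup_compl] at this
      exact (le_top (a := w.1)).trans this)
    (fun s x u h z h1 h2 => by
      have h3 : z.1 ≤ x.1 ⊓ sSup (Subtype.val '' s) := le_inf h1 h2
      rw [inf_sSup_of_commutes (by
        rintro _ ⟨y, hy, rfl⟩; exact hR.commutes _ x.2 _ y.2)] at h3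
      refine h3.trans (iSup₂_le ?_)
      rintro _ ⟨y, hy, rfl⟩
      exact h y hy ⟨x.1 ⊓ y.1, hR.inf_mem x.2 y.2⟩ (inf_le_left (a := x.1))
        (inf_le_right (a := x.1)))

end IsBooleanSubset

variable (P) in
/-- The piecewise Boolean operations of a complete orthomodular lattice. -/
@[reducible] def toPCBData : PCBData P where
  comm := Commutes
  comm_refl := commutes_refl
  comm_symm _ _ h := h.symm
  neg p := pᶜ
  sup X _ := sSup X

variable (P) in
/-- A complete orthomodular lattice as a piecewise complete Boolean algebra. -/
@[reducible] def toPiecewiseCBA : PiecewiseCBA P :=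
  letI := toPCBData P
  { toPCBData P with
    exists_subalgebra := fun S hS =>
      have hR := isBooleanSubset_bicommutant hS
      ⟨_, subset_bicommutant S, ⟨{
        pairwise_comm := hR.commutes
        alg := hR.completeBooleanAlgebra
        coe_compl := fun _ => rfl
        coe_sSup := fun _ _ => rfl }⟩⟩ }

end CompleteOrthomodularLattice

/-! # The order of a piecewise complete Boolean algebra -/

theorem PCBData.sup_congr {B : Type u} [PCBData B] {X Y : Set B} (h : X = Y)
    (hX : PairwiseRel comm X) (hY : PairwiseRel comm Y) : sup X hX = sup Y hY := by
  subst h; rfl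

namespace CommeasurableSubalgebra

variable {B : Type u} [PCBData B] {T : Set B}

theorem sup_mem (A : CommeasurableSubalgebra T) {X : Set B} (hX : PairwiseRel PCBData.comm X) (h : X ⊆ T) :
    PCBData.sup X hX ∈ T := by
  have e : Subtype.val '' (Subtype.val ⁻¹' X : Set T) = X := by simpa using h
  let _ := A.alg
  rw [← PCBData.sup_congr e (by rwa [e]) hX, ← A.coe_sSup]
  exact Subtype.prop _

theorem neg_mem (A : CommeasurableSubalgebra T) {x : B} (h : x ∈ T) : PCBData.neg x ∈ T := by
  let _ := A.alg
  rw [← A.coe_compl ⟨x, h⟩]; exact Subtype.prop _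

theorem sSup_eq (A : CommeasurableSubalgebra T) {X : Set B} (hX : PairwiseRel PCBData.comm X) (h : X ⊆ T) :
    A.alg.sSup (Subtype.val ⁻¹' X) = ⟨PCBData.sup X hX, A.sup_mem hX h⟩ := by
  have e : Subtype.val '' (Subtype.val ⁻¹' X : Set T) = X := by simpa using h
  let _ := A.alg
  apply Subtype.ext
  rw [A.coe_sSup _ (by rwa [e])]
  exact PCBData.sup_congr e _ hX

theorem isLUB_sup (A : CommeasurableSubalgebra T) {X : Set B} (hX : PairwiseRel PCBData.comm X) (h : X ⊆ T) :
    letI := A.alg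
    IsLUB (Subtype.val ⁻¹' X : Set T) ⟨PCBData.sup X hX, A.sup_mem hX h⟩ := by
  let _ := A.alg
  rw [← A.sSup_eq hX h]
  exact isLUB_sSup _

theorem pairwiseRel_pair (A : CommeasurableSubalgebra T) (x y : T) :
    PairwiseRel PCBData.comm ({x.1, y.1} : Set B) := by
  rintro _ (rfl | rfl) _ (rfl | rfl) <;> exact A.pairwise_comm _ (Subtype.prop _) _ (Subtype.prop _)

theorem coe_sup_eq (A : CommeasurableSubalgebra T) (x y : T) :
    (A.alg.sup x y).1 = PCBData.sup {x.1, y.1} (A.pairwiseRel_pair x y) := by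
  let _ := A.alg
  have h1 : ({x.1, y.1} : Set B) ⊆ T := by rintro _ (rfl | rfl) <;> simp
  refine congrArg Subtype.val (a₂ := ⟨_, A.sup_mem _ h1⟩) (IsLUB.unique (isLUB_pair (a := x) (b := y)) ?_)
  convert A.isLUB_sup (A.pairwiseRel_pair x y) h1
  ext z; simp [Subtype.ext_iff]

theorem coe_bot_eq (A : CommeasurableSubalgebra T) :
    A.alg.bot.1 = PCBData.sup ∅ (fun _ h => h.elim) := by
  let _ := A.alg
  refine congrArg Subtype.val (a₂ := ⟨_, A.sup_mem _ (Set.empty_subset T)⟩) (IsLUB.unique (s := (∅ : Set T)) isLUB_empty ?_)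
  simpa only [Set.preimage_empty] using A.isLUB_sup (fun _ h => h.elim) (Set.empty_subset T)

theorem le_iff (A : CommeasurableSubalgebra T) {x y : T} :
    A.alg.le x y ↔ PCBData.sup {x.1, y.1} (A.pairwiseRel_pair x y) = y.1 := by
  rw [← A.coe_sup_eq]
  let _ := A.alg
  exact sup_eq_right.symm.trans Subtype.ext_iff

end CommeasurableSubalgebra

section

variable {B : Type u}

theorem inducedLE_iff_sup_eq [PCBData B] {x y : B} (hxy : inducedLE x y) :
    ∃ h : PairwiseRel PCBData.comm {x, y}, PCBData.sup {x, y} h = y := by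
  obtain ⟨T, A, hx, hy, h⟩ := hxy
  exact ⟨_, A.le_iff.1 h⟩

/-- The condition that the supremum of `x` and `y` is `y` does not mention a subalgebra, so all
subalgebras containing both elements order them alike. -/
theorem CommeasurableSubalgebra.inducedLE_iff [PCBData B] {T : Set B}
    (A : CommeasurableSubalgebra T) {x y : T} : inducedLE x.1 y.1 ↔ A.alg.le x y := by
  refine ⟨fun h => ?_, fun h => ⟨T, A, x.2, y.2, h⟩⟩
  obtain ⟨_, h⟩ := inducedLE_iff_sup_eq h
  exact A.le_iff.2 h

namespace PiecewiseCBA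

theorem pairwiseRel_pair [PCBData B] {x y : B} (h : PCBData.comm x y) :
    PairwiseRel PCBData.comm {x, y} := by
  rintro a (rfl | rfl) b (rfl | rfl)
  exacts [PCBData.comm_refl _, h, PCBData.comm_symm _ _ h, PCBData.comm_refl _]

theorem comm_of_le [PCBData B] {x y : B} (h : inducedLE x y) : PCBData.comm x y := by
  obtain ⟨T, A, hx, hy, _⟩ := h
  exact A.pairwise_comm _ hx _ hy

variable [PiecewiseCBA B]

theorem exists_pair {x y : B} (h : PCBData.comm x y) :
    ∃ T : Set B, x ∈ T ∧ y ∈ T ∧ Nonempty (CommeasurableSubalgebra T) := by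
  obtain ⟨T, hT, A⟩ := exists_subalgebra _ (pairwiseRel_pair h)
  exact ⟨T, hT (by simp), hT (by simp), A⟩

theorem le_iff {x y : B} :
    inducedLE x y ↔ ∃ h : PairwiseRel PCBData.comm {x, y}, PCBData.sup {x, y} h = y := by
  refine ⟨inducedLE_iff_sup_eq, fun ⟨h, e⟩ => ?_⟩
  obtain ⟨T, hx, hy, ⟨A⟩⟩ := exists_pair (h x (by simp) y (by simp))
  exact ⟨T, A, hx, hy, A.le_iff.2 e⟩

theorem le_refl (x : B) : inducedLE x x := by
  obtain ⟨T, hx, _, ⟨A⟩⟩ := exists_pair (PCBData.comm_refl x)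
  exact ⟨T, A, hx, hx, A.alg.le_refl _⟩

theorem le_antisymm {x y : B} (h : inducedLE x y) (h' : inducedLE y x) : x = y := by
  obtain ⟨T, A, hx, hy, h⟩ := h
  exact congrArg Subtype.val
    (A.alg.le_antisymm _ _ h (A.inducedLE_iff (x := ⟨y, hy⟩) (y := ⟨x, hx⟩) |>.1 h'))

theorem neg_neg (x : B) : PCBData.neg (PCBData.neg x) = x := by
  obtain ⟨T, hx, _, ⟨A⟩⟩ := exists_pair (PCBData.comm_refl x)
  let _ := A.alg
  rw [← A.coe_compl ⟨x, hx⟩, ← A.coe_compl, compl_compl]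

theorem comm_neg {x y : B} (h : PCBData.comm x y) : PCBData.comm x (PCBData.neg y) := by
  obtain ⟨T, hx, hy, ⟨A⟩⟩ := exists_pair h
  exact A.pairwise_comm _ hx _ (A.neg_mem hy)

theorem neg_anti {x y : B} (h : inducedLE x y) : inducedLE (PCBData.neg y) (PCBData.neg x) := by
  obtain ⟨T, A, hx, hy, h⟩ := h
  let _ := A.alg
  rw [← A.coe_compl ⟨x, hx⟩, ← A.coe_compl ⟨y, hy⟩, A.inducedLE_iff]
  exact compl_le_compl h

theorem le_sup {X : Set B} (hX : PairwiseRel PCBData.comm X) {x : B} (hx : x ∈ X) :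
    inducedLE x (PCBData.sup X hX) := by
  obtain ⟨T, hT, ⟨A⟩⟩ := exists_subalgebra X hX
  let _ := A.alg
  exact A.inducedLE_iff (x := ⟨x, hT hx⟩) |>.2 ((A.isLUB_sup hX hT).1 hx)

/-- Comparable elements are commeasurable, so `X` and `z` lie in one subalgebra. Transitivity is not
needed. -/
theorem sup_le {X : Set B} (hX : PairwiseRel PCBData.comm X) {z : B}
    (hz : ∀ x ∈ X, inducedLE x z) : inducedLE (PCBData.sup X hX) z := by
  have hX' : PairwiseRel PCBData.comm (insert z X) := by
    rintro a (rfl | ha) b (rfl | hb)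
    · exact PCBData.comm_refl _
    · exact PCBData.comm_symm _ _ (comm_of_le (hz b hb))
    · exact comm_of_le (hz a ha)
    · exact hX a ha b hb
  obtain ⟨T, hT, ⟨A⟩⟩ := exists_subalgebra _ hX'
  let _ := A.alg
  have h1 : X ⊆ T := (Set.subset_insert _ _).trans hT
  exact A.inducedLE_iff (x := ⟨_, A.sup_mem hX h1⟩) (y := ⟨z, hT (by simp)⟩) |>.2
    ((A.isLUB_sup hX h1).2 fun x hx => A.inducedLE_iff.1 (hz x.1 hx))

end PiecewiseCBA

/-- Morphisms are monotone. -/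
theorem PCBHom.map_le {B C : Type u} [PCBData B] [PiecewiseCBA C] (f : PCBHom B C) {x y : B}
    (h : inducedLE x y) : inducedLE (f.toFun x) (f.toFun y) := by
  obtain ⟨h1, h2⟩ := inducedLE_iff_sup_eq h
  have e : f.toFun '' {x, y} = {f.toFun x, f.toFun y} := by simp [Set.image_pair]
  refine PiecewiseCBA.le_iff.2 ⟨e ▸ h1.image f.map_comm, ?_⟩
  conv_rhs => rw [← h2, f.map_sup]
  exact PCBData.sup_congr e.symm _ _

end

/-! # From transitive joined piecewise Boolean algebras to orthomodular lattices -/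

/-- In a partial order in which chains have suprema and any two elements have a supremum, every
set which contains the suprema of its chains and of its pairs has a greatest element. -/
theorem exists_isGreatest_of_chain_closed {B : Type u} [PartialOrder B] {L : Set B}
    (hchain : ∀ c ⊆ L, IsChain (· ≤ ·) c → ∃ s ∈ L, s ∈ upperBounds c)
    (hpair : ∀ x ∈ L, ∀ y ∈ L, ∃ s ∈ L, x ≤ s ∧ y ≤ s) : ∃ m, IsGreatest L m := by
  obtain ⟨m, hm⟩ := zorn_le₀ L fun c hc hc' => by
    obtain ⟨s, hs, h⟩ := hchain c hc hc'
    exact ⟨s, hs, h⟩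
  -- In a directed set a maximal element is greatest.
  refine ⟨m, hm.1, fun l hl => ?_⟩
  obtain ⟨s, hs, h1, h2⟩ := hpair m hm.1 l hl
  exact h2.trans (hm.2 hs h1)

section

variable (B : Type u) [PiecewiseCBA B]

/-- The partial order on a transitive piecewise complete Boolean algebra. -/
@[reducible] def inducedPartialOrder (ht : IsTransitivePCB B) : PartialOrder B where
  le := inducedLE
  le_refl := PiecewiseCBA.le_refl
  le_trans := ht
  le_antisymm _ _ := PiecewiseCBA.le_antisymm

/-- The lower bounds of all upper bounds of `S` are closed under suprema of chains, which are
commeasurable, and under binary joins. Their greatest element is the supremum of `S`. -/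
theorem IsJoinedPCB.exists_isLUB (ht : IsTransitivePCB B) (hj : IsJoinedPCB B) (S : Set B) :
    letI := inducedPartialOrder B ht
    ∃ s, IsLUB S s := by
  let _ := inducedPartialOrder B ht
  obtain ⟨m, hm⟩ : ∃ m, IsGreatest (lowerBounds (upperBounds S)) m := by
    refine exists_isGreatest_of_chain_closed ?_ ?_
    · intro c hc hc'
      have hX : PairwiseRel PCBData.comm c := by
        intro x hx y hy
        rcases hc'.total hx hy with h | h
        · exact PiecewiseCBA.comm_of_le h
        · exact PCBData.comm_symm _ _ (PiecewiseCBA.comm_of_le h)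
      exact ⟨PCBData.sup c hX, fun u hu => PiecewiseCBA.sup_le hX fun x hx => hc hx hu,
        fun x hx => PiecewiseCBA.le_sup hX hx⟩
    · intro x hx y hy
      obtain ⟨j, h1, h2, h3⟩ := hj x y
      exact ⟨j, fun u hu => h3 u (hx hu) (hy hu), h1, h2⟩
  exact ⟨m, fun x hx => hm.2 fun u hu => hu hx, hm.1⟩

/-- The complete lattice of a transitive joined piecewise complete Boolean algebra. -/
@[reducible] noncomputable def inducedCompleteLattice (ht : IsTransitivePCB B)
    (hj : IsJoinedPCB B) : CompleteLattice B :=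
  letI := inducedPartialOrder B ht
  letI : SupSet B := ⟨fun S => (IsJoinedPCB.exists_isLUB B ht hj S).choose⟩
  completeLatticeOfSup B fun S => (IsJoinedPCB.exists_isLUB B ht hj S).choose_spec

variable {B}

theorem CommeasurableSubalgebra.coe_sup {T : Set B} (A : CommeasurableSubalgebra T)
    (ht : IsTransitivePCB B) (hj : IsJoinedPCB B) (x y : T) :
    (A.alg.sup x y).1 = (inducedCompleteLattice B ht hj).sup x.1 y.1 := by
  rw [A.coe_sup_eq]
  let _ := inducedCompleteLattice B ht hj
  exact IsLUB.unique (s := {x.1, y.1}) ⟨fun a ha => PiecewiseCBA.le_sup _ ha,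
    fun z hz => PiecewiseCBA.sup_le _ hz⟩ isLUB_pair

/-- By De Morgan the meet in `T` is the negation of a supremum of commeasurable elements, and
negation reverses the order of all of `B`. -/
theorem CommeasurableSubalgebra.coe_inf {T : Set B} (A : CommeasurableSubalgebra T)
    (ht : IsTransitivePCB B) (hj : IsJoinedPCB B) (x y : T) :
    (A.alg.inf x y).1 = (inducedCompleteLattice B ht hj).inf x.1 y.1 := by
  let _ := A.alg
  have hl : inducedLE (x ⊓ y).1 x.1 := A.inducedLE_iff.2 inf_le_left
  have hr : inducedLE (x ⊓ y).1 y.1 := A.inducedLE_iff.2 inf_le_right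
  have h : x ⊓ y = (xᶜ ⊔ yᶜ)ᶜ := by simp
  have hc : (xᶜ ⊔ yᶜ).1 = _ := A.coe_sup_eq xᶜ yᶜ
  let _ := inducedCompleteLattice B ht hj
  refine IsGLB.unique (s := {x.1, y.1}) ⟨?_, fun z hz => ?_⟩ isGLB_pair
  · rintro _ (rfl | rfl)
    exacts [hl, hr]
  · change inducedLE z (A.alg.inf x y).1
    rw [show A.alg.inf x y = _ from h, A.coe_compl, hc, ← PiecewiseCBA.neg_neg z]
    refine PiecewiseCBA.neg_anti (PiecewiseCBA.sup_le _ ?_)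
    rintro _ (rfl | rfl)
    · rw [A.coe_compl]; exact PiecewiseCBA.neg_anti (hz (by simp))
    · rw [A.coe_compl]; exact PiecewiseCBA.neg_anti (hz (by simp))

theorem CommeasurableSubalgebra.coe_bot {T : Set B} (A : CommeasurableSubalgebra T)
    (ht : IsTransitivePCB B) (hj : IsJoinedPCB B) :
    A.alg.bot.1 = (inducedCompleteLattice B ht hj).bot := by
  rw [A.coe_bot_eq]
  let _ := inducedCompleteLattice B ht hj
  exact le_bot_iff.1 (PiecewiseCBA.sup_le _ (by simp))

theorem CommeasurableSubalgebra.coe_top {T : Set B} (A : CommeasurableSubalgebra T)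
    (ht : IsTransitivePCB B) (hj : IsJoinedPCB B) :
    A.alg.top.1 = (inducedCompleteLattice B ht hj).top := by
  have h : A.alg.top.1 = PCBData.neg A.alg.bot.1 := by
    let _ := A.alg
    rw [← A.coe_compl]
    exact congrArg Subtype.val compl_bot.symm
  rw [h, A.coe_bot ht hj]
  let _ := inducedCompleteLattice B ht hj
  refine top_le_iff.1 ?_
  change inducedLE (⊤ : B) _
  rw [← PiecewiseCBA.neg_neg (⊤ : B)]
  exact PiecewiseCBA.neg_anti (bot_le (α := B))

variable (B) in
/-- The complete orthomodular lattice of a transitive joined piecewise complete Boolean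
algebra. -/
@[reducible] noncomputable def inducedOrthomodularLattice (ht : IsTransitivePCB B)
    (hj : IsJoinedPCB B) : CompleteOrthomodularLattice B :=
  letI := inducedCompleteLattice B ht hj
  { inducedCompleteLattice B ht hj with
    compl := PCBData.neg
    compl_anti := fun _ _ => PiecewiseCBA.neg_anti
    compl_invol := PiecewiseCBA.neg_neg
    -- This law and the next two involve only commeasurable elements, so each is verified in a
    -- Boolean subalgebra, whose operations agree with those of the lattice.
    sup_compl := fun p => by
      obtain ⟨T, hp, _, ⟨A⟩⟩ := PiecewiseCBA.exists_pair (PCBData.comm_refl p)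
      let _ := A.alg
      change p ⊔ PCBData.neg p = ⊤
      rw [← show _ = PCBData.neg p from A.coe_compl ⟨p, hp⟩, ← show _ = ⊤ from A.coe_top ht hj,
        ← show _ = _ ⊔ _ from A.coe_sup ht hj ⟨p, hp⟩ _]
      exact congrArg Subtype.val sup_compl_eq_top
    inf_compl := fun p => by
      obtain ⟨T, hp, _, ⟨A⟩⟩ := PiecewiseCBA.exists_pair (PCBData.comm_refl p)
      let _ := A.alg
      change p ⊓ PCBData.neg p = ⊥
      rw [← show _ = PCBData.neg p from A.coe_compl ⟨p, hp⟩, ← show _ = ⊥ from A.coe_bot ht hj,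
        ← show _ = _ ⊓ _ from A.coe_inf ht hj ⟨p, hp⟩ _]
      exact congrArg Subtype.val inf_compl_eq_bot
    orthomodular := fun p q hpq => by
      obtain ⟨T, A, hp, hq, h⟩ := hpq
      let _ := A.alg
      change p ⊔ (PCBData.neg p ⊓ q) = q
      rw [← show _ = PCBData.neg p from A.coe_compl ⟨p, hp⟩,
        ← show _ = _ ⊓ _ from A.coe_inf ht hj _ ⟨q, hq⟩,
        ← show _ = _ ⊔ _ from A.coe_sup ht hj ⟨p, hp⟩ _]
      refine congrArg Subtype.val (a₂ := (⟨q, hq⟩ : T)) ?_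
      change (⟨p, hp⟩ : T) ⊔ (⟨p, hp⟩ᶜ ⊓ ⟨q, hq⟩) = _
      rw [sup_inf_left, sup_compl_eq_top, top_inf_eq]
      exact sup_eq_right.2 h }

-- Commeasurable elements commute by distributivity in a common subalgebra. Conversely, commuting
-- `x` and `y` are joins of the pieces `x ⊓ y`, `x ⊓ yᶜ`, `y ⊓ xᶜ`. These are mutually orthogonal,
-- hence commeasurable, so a single subalgebra contains them and their joins.
open CompleteOrthomodularLattice in
theorem comm_iff_commutes (ht : IsTransitivePCB B) (hj : IsJoinedPCB B) (x y : B) :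
    PCBData.comm x y ↔
      letI := inducedOrthomodularLattice B ht hj
      Commutes x y := by
  constructor
  · intro h
    obtain ⟨T, hx, hy, ⟨A⟩⟩ := PiecewiseCBA.exists_pair h
    let _ := A.alg
    let _ := inducedOrthomodularLattice B ht hj
    change x = (x ⊓ y) ⊔ (x ⊓ PCBData.neg y)
    rw [← show _ = PCBData.neg y from A.coe_compl ⟨y, hy⟩,
      ← show _ = _ ⊓ _ from A.coe_inf ht hj ⟨x, hx⟩ ⟨y, hy⟩,
      ← show _ = _ ⊓ _ from A.coe_inf ht hj ⟨x, hx⟩ _,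
      ← show _ = _ ⊔ _ from A.coe_sup ht hj _ _]
    refine congrArg Subtype.val (a₁ := (⟨x, hx⟩ : T)) ?_
    change (⟨x, hx⟩ : T) = (⟨x, hx⟩ ⊓ ⟨y, hy⟩) ⊔ (⟨x, hx⟩ ⊓ ⟨y, hy⟩ᶜ)
    rw [← inf_sup_left, sup_compl_eq_top, inf_top_eq]
  · intro h
    let _ := inducedOrthomodularLattice B ht hj
    change Commutes x y at h
    have horth : ∀ a b : B, a ≤ bᶜ → PCBData.comm a b := fun a b h => by
      have := PiecewiseCBA.comm_neg (PiecewiseCBA.comm_of_le h)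
      rwa [show PCBData.neg bᶜ = b from PiecewiseCBA.neg_neg b] at this
    have hac : (x ⊓ y) ≤ (y ⊓ xᶜ)ᶜ :=
      inf_le_left.trans (le_compl_comm inf_le_right)
    have hab : (x ⊓ y) ≤ (x ⊓ yᶜ)ᶜ :=
      inf_le_right.trans (le_compl_comm inf_le_right)
    have hbc : (x ⊓ yᶜ) ≤ (y ⊓ xᶜ)ᶜ :=
      inf_le_left.trans (le_compl_comm inf_le_right)
    have hS : PairwiseRel PCBData.comm ({x ⊓ y, x ⊓ yᶜ, y ⊓ xᶜ} : Set B) := by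
      rintro a (rfl | rfl | rfl) b (rfl | rfl | rfl)
      exacts [PCBData.comm_refl _, horth _ _ hab, horth _ _ hac,
        PCBData.comm_symm _ _ (horth _ _ hab), PCBData.comm_refl _, horth _ _ hbc,
        PCBData.comm_symm _ _ (horth _ _ hac), PCBData.comm_symm _ _ (horth _ _ hbc),
        PCBData.comm_refl _]
    obtain ⟨T, hT, ⟨A⟩⟩ := PiecewiseCBA.exists_subalgebra _ hS
    have h1 : x ⊓ y ∈ T := hT (by simp)
    have h2 : x ⊓ yᶜ ∈ T := hT (by simp)
    have h3 : y ⊓ xᶜ ∈ T := hT (by simp)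
    have hx : x ∈ T := by
      rw [h, ← show _ = _ ⊔ _ from A.coe_sup ht hj ⟨_, h1⟩ ⟨_, h2⟩]
      exact Subtype.prop _
    have hy : y ∈ T := by
      rw [h.symm, ← show _ = _ ⊔ _ from A.coe_sup ht hj ⟨y ⊓ x, by rwa [inf_comm]⟩ ⟨_, h3⟩]
      exact Subtype.prop _
    exact A.pairwise_comm _ hx _ hy

end

/-! # Complete orthomodular lattices as piecewise complete Boolean algebras -/

namespace CompleteOrthomodularLattice

section

variable {P : Type u} [CompleteOrthomodularLattice P]

theorem inducedLE_iff {x y : P} :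
    letI := toPCBData P
    inducedLE x y ↔ x ≤ y := by
  let _ := toPiecewiseCBA P
  change inducedLE x y ↔ x ≤ y
  rw [PiecewiseCBA.le_iff]
  constructor
  · rintro ⟨_, e⟩
    rw [← e]
    exact le_sSup (by simp)
  · intro h
    refine ⟨PiecewiseCBA.pairwiseRel_pair (commutes_of_le h), ?_⟩
    change sSup {x, y} = y
    rw [sSup_pair, sup_eq_right.2 h]

theorem isBinaryJoin_iff {x y j : P} :
    letI := toPCBData P
    IsBinaryJoin x y j ↔ j = x ⊔ y := by
  constructor
  · rintro ⟨h1, h2, h3⟩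
    refine le_antisymm (inducedLE_iff.1 (h3 _ ?_ ?_)) (sup_le (inducedLE_iff.1 h1) (inducedLE_iff.1 h2))
    · exact inducedLE_iff.2 le_sup_left
    · exact inducedLE_iff.2 le_sup_right
  · rintro rfl
    exact ⟨inducedLE_iff.2 le_sup_left, inducedLE_iff.2 le_sup_right, fun z h1 h2 =>
      inducedLE_iff.2 (sup_le (inducedLE_iff.1 h1) (inducedLE_iff.1 h2))⟩

end

variable {P Q : Type u} [CompleteOrthomodularLattice P] [CompleteOrthomodularLattice Q]

theorem _root_.COMLHom.map_sup (f : COMLHom P Q) (p q : P) :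
    f.toFun (p ⊔ q) = f.toFun p ⊔ f.toFun q := by
  rw [← sSup_pair, f.map_sSup, Set.image_pair, sSup_pair]

theorem _root_.COMLHom.map_inf (f : COMLHom P Q) (p q : P) :
    f.toFun (p ⊓ q) = f.toFun p ⊓ f.toFun q := by
  rw [← compl_invol (p ⊓ q), compl_inf, f.map_compl, f.map_sup, f.map_compl, f.map_compl,
    ← compl_inf, compl_invol]

theorem _root_.COMLHom.map_commutes (f : COMLHom P Q) {p q : P} (h : Commutes p q) :
    Commutes (f.toFun p) (f.toFun q) := by
  unfold Commutes
  conv_lhs => rw [h]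
  rw [f.map_sup, f.map_inf, f.map_inf, f.map_compl]

/-- A function which preserves binary suprema and suprema of chains preserves all suprema. -/
theorem map_sSup_of_commuting {f : P → Q} (hsup : ∀ p q, f (p ⊔ q) = f p ⊔ f q)
    (hchain : ∀ X : Set P, (∀ p ∈ X, ∀ q ∈ X, Commutes p q) → f (sSup X) = sSup (f '' X))
    (X : Set P) : f (sSup X) = sSup (f '' X) := by
  have hmono : Monotone f := fun p q h => by
    rw [← sup_eq_right.2 h, hsup]; exact le_sup_left
  refine le_antisymm ?_ (sSup_le (by rintro _ ⟨x, hx, rfl⟩; exact hmono (le_sSup hx)))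
  -- Chains commute, so this set is closed under suprema of chains as well as binary joins. Its
  -- greatest element bounds `X`.
  obtain ⟨m, hm⟩ : ∃ m, IsGreatest {p | f p ≤ sSup (f '' X)} m := by
    refine exists_isGreatest_of_chain_closed (fun c hc hc' => ?_) fun x hx y hy =>
      ⟨x ⊔ y, ?_, le_sup_left, le_sup_right⟩
    · refine ⟨sSup c, ?_, fun x hx => le_sSup hx⟩
      rw [Set.mem_ofPred_eq, hchain c fun p hp q hq => ?_]
      · refine sSup_le ?_
        rintro _ ⟨x, hx, rfl⟩
        exact hc hx
      · rcases hc'.total hp hq with h | h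
        exacts [commutes_of_le h, (commutes_of_le h).symm]
    · rw [Set.mem_ofPred_eq, hsup]
      exact sup_le hx hy
  exact (hmono (sSup_le fun x hx => hm.2 (le_sSup ⟨x, hx, rfl⟩))).trans hm.1

end CompleteOrthomodularLattice

/-! ### Equivalence of orthomodular lattices and transitive joined piecewise Boolean algebras -/

open CompleteOrthomodularLattice

/-- The transitive joined piecewise complete Boolean algebra of a complete orthomodular
lattice. -/
@[reducible] def COML.toTJPCBoolean (P : COML.{u}) : TJPCBoolean.{u} where
  obj := @PCBoolean.mk P.carrier (toPiecewiseCBA P.carrier)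
  transitive _ _ _ h h' := inducedLE_iff.2 ((inducedLE_iff.1 h).trans (inducedLE_iff.1 h'))
  joined _ _ := ⟨_, isBinaryJoin_iff.2 rfl⟩

/-- The functor regarding complete orthomodular lattices as piecewise Boolean algebras. -/
def comlToTJPCBoolean : COML.{u} ⥤ TJPCBoolean.{u} where
  obj := COML.toTJPCBoolean
  map {P Q} f :=
    ⟨letI := toPCBData P.carrier
     letI := toPCBData Q.carrier
     { toFun := COMLHom.toFun f
       map_comm := fun _ _ => COMLHom.map_commutes f
       map_neg := COMLHom.map_compl f
       map_sup := fun X _ => COMLHom.map_sSup f X },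
     fun x y j h => isBinaryJoin_iff.2 (by
       rw [isBinaryJoin_iff.1 h]; exact COMLHom.map_sup f x y)⟩

instance : comlToTJPCBoolean.{u}.Faithful where
  map_injective h := COMLHom.ext (congrArg (fun k => PCBHom.toFun k.1) h)

instance : comlToTJPCBoolean.{u}.Full where
  map_surjective {P Q} f := by
    let _ := toPCBData P.carrier
    let _ := toPCBData Q.carrier
    let g : PCBHom P.carrier Q.carrier := f.1
    have hg : PreservesBinaryJoins g.toFun := f.2
    exact ⟨({
      toFun := g.toFun
      map_compl := g.map_neg
      map_sSup := map_sSup_of_commuting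
        (fun p q => isBinaryJoin_iff.1 (hg p q _ (isBinaryJoin_iff.2 rfl)))
        fun X hX => g.map_sup X hX } : COMLHom P.carrier Q.carrier), rfl⟩

/-- A bijection preserving and reflecting commeasurability and preserving the operations is an
isomorphism of transitive joined piecewise complete Boolean algebras. -/
theorem TJPCBoolean.nonempty_iso {B C : TJPCBoolean.{u}} (e : B.obj.carrier ≃ C.obj.carrier)
    (hcomm : ∀ x y, PCBData.comm x y ↔ PCBData.comm (e x) (e y))
    (hneg : ∀ x, e (PCBData.neg x) = PCBData.neg (e x))
    (hsup : ∀ X hX hX', e (PCBData.sup X hX) = PCBData.sup (e '' X) hX') : Nonempty (B ≅ C) := by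
  let f : PCBHom B.obj.carrier C.obj.carrier :=
    ⟨e, fun x y => (hcomm x y).1, hneg, fun X hX => hsup X hX _⟩
  have hcomm' : ∀ x y, PCBData.comm x y → PCBData.comm (e.symm x) (e.symm y) := fun x y h => by
    rw [hcomm]; simpa using h
  let g : PCBHom C.obj.carrier B.obj.carrier :=
    ⟨e.symm, hcomm', fun x => e.injective (by rw [hneg]; simp), fun X hX => by
      refine e.injective ?_
      rw [hsup _ (hX.image hcomm') (by simpa [← Set.image_comp] using hX), e.apply_symm_apply]
      exact PCBData.sup_congr (by simp [← Set.image_comp]) _ _⟩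
  -- Both directions are monotone, so inequalities transpose across `e` and the universal property
  -- of binary joins is transported.
  have hfg : ∀ x y, inducedLE (e x) y → inducedLE x (e.symm y) := fun x y h => by
    simpa [g] using g.map_le h
  have hgf : ∀ x y, inducedLE (e.symm x) y → inducedLE x (e y) := fun x y h => by
    simpa [f] using f.map_le h
  refine ⟨⟨⟨f, fun x y j h => ⟨f.map_le h.1, f.map_le h.2.1, fun z h1 h2 => ?_⟩⟩,
    ⟨g, fun x y j h => ⟨g.map_le h.1, g.map_le h.2.1, fun z h1 h2 => ?_⟩⟩, ?_, ?_⟩⟩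
  · simpa [f] using f.map_le (h.2.2 _ (hfg _ _ h1) (hfg _ _ h2))
  · simpa [g] using g.map_le (h.2.2 _ (hgf _ _ h1) (hgf _ _ h2))
  · exact Subtype.ext (PCBHom.ext (funext e.symm_apply_apply))
  · exact Subtype.ext (PCBHom.ext (funext e.apply_symm_apply))

instance : comlToTJPCBoolean.{u}.EssSurj where
  mem_essImage B := by
    let P : COML.{u} := @COML.mk B.obj.carrier
      (inducedOrthomodularLattice B.obj.carrier B.transitive B.joined)
    refine ⟨P, TJPCBoolean.nonempty_iso (B := P.toTJPCBoolean) (Equiv.refl _)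
      (fun x y => (comm_iff_commutes B.transitive B.joined x y).symm) (fun _ => rfl) ?_⟩
    intro X hX hX'
    let _ := inducedOrthomodularLattice B.obj.carrier B.transitive B.joined
    -- The two suprema are least upper bounds for the same order.
    refine IsLUB.unique (isLUB_sSup X) ?_
    simp only [Equiv.coe_refl, Set.image_id] at hX' ⊢
    exact ⟨fun x hx => PiecewiseCBA.le_sup hX' hx, fun z hz => PiecewiseCBA.sup_le hX' hz⟩

instance : comlToTJPCBoolean.{u}.IsEquivalence where

/-! # Commutative AW*-algebras -/

section

open WeakDual

variable {C D : Type u} [CommCStarAlgebra C] [CommCStarAlgebra D]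

open scoped CStarAlgebra in
theorem continuous_starAlgHom (φ : C →⋆ₐ[ℂ] D) : Continuous φ := map_continuous φ

/-- The projections of a commutative AW*-algebra separate the characters. -/
theorem IsAWStarAlgebra.exists_separating (hC : IsAWStarAlgebra C) {x y : characterSpace ℂ C}
    (h : x ≠ y) : ∃ p : C, IsStarProjection p ∧ x p ≠ y p := by
  obtain ⟨c₀, hc₀⟩ : ∃ c, x c ≠ y c := by
    by_contra! H
    exact h (CharacterSpace.ext H)
  -- A tent in the variable `t c₀`, positive at `z` and zero once `t c₀` is at least half of `dist
  -- (x c₀) (y c₀)` away from `z c₀`. By the triangle inequality the tents at `x` and `y` have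
  -- product zero.
  let F (z : characterSpace ℂ C) : C(characterSpace ℂ C, ℂ) :=
    ⟨fun t => ((max 0 (dist (x c₀) (y c₀) / 2 - dist (t c₀) (z c₀)) : ℝ) : ℂ), by
      have := (gelfandTransform ℂ C c₀).continuous
      have : Continuous fun t : characterSpace ℂ C => t c₀ := this
      exact Complex.continuous_ofReal.comp
        (continuous_const.max (continuous_const.sub (this.dist continuous_const)))⟩
  let G (z : characterSpace ℂ C) : C := (gelfandStarTransform C).symm (F z)
  have hG (z t : characterSpace ℂ C) : t (G z) = F z t := by
    have : gelfandStarTransform C (G z) = F z := StarAlgEquiv.apply_symm_apply _ _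
    rw [← this]; rfl
  have hd : 0 < dist (x c₀) (y c₀) := dist_pos.2 hc₀
  have hGz (z : characterSpace ℂ C) : z (G z) ≠ 0 := by
    rw [hG]
    simp only [F, ContinuousMap.coe_mk, dist_self, sub_zero]
    rw [max_eq_right (by positivity)]
    exact_mod_cast (by positivity)
  have hGG : G x * G y = 0 := by
    apply (gelfandStarTransform C).injective
    rw [map_mul, map_zero]
    ext t
    change t (G x) * t (G y) = 0
    rw [hG, hG]
    simp only [F, ContinuousMap.coe_mk]
    have h3 := dist_triangle_left (x c₀) (y c₀) (t c₀)
    rcases le_total (dist (x c₀) (y c₀) / 2) (dist (t c₀) (x c₀)) with h1 | h1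
    · rw [max_eq_left (by linarith)]; simp
    · rw [max_eq_left (b := _ - dist (t c₀) (y c₀)) (by linarith)]; simp
  -- The generator `p` of the annihilator of `G x` vanishes at `x`, where `G x` does not, but not at
  -- `y`, since `G y` is a multiple of `p`.
  obtain ⟨p, hp, hann⟩ := hC {G x}
  refine ⟨p, hp, ?_⟩
  have h1 : G x * p = 0 := by
    have : p ∈ {y : C | ∀ x_1 ∈ ({G x} : Set C), x_1 * y = 0} := by
      rw [hann]; exact ⟨1, by simp⟩
    exact this _ rfl
  obtain ⟨z, hz⟩ : G y ∈ {y : C | ∃ z, y = p * z} := by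
    rw [← hann]; rintro _ rfl; exact hGG
  have h2 : x p = 0 := by
    have := congrArg x h1
    rw [map_mul, map_zero] at this
    exact (mul_eq_zero.1 this).resolve_left (hGz x)
  have h3 : y p ≠ 0 := fun h0 => hGz y (by rw [hz, map_mul, h0, zero_mul])
  rw [h2]
  exact h3.symm

/-- A commutative AW*-algebra is the closed star subalgebra generated by its projections. -/
theorem IsAWStarAlgebra.eq_top_of_projections_mem (hC : IsAWStarAlgebra C)
    {S : StarSubalgebra ℂ C} (hS : IsClosed (S : Set C)) (hp : ∀ p, IsStarProjection p → p ∈ S) :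
    S = ⊤ := by
  let e := gelfandStarTransform C
  have h1 : (S.map e.toStarAlgHom).SeparatesPoints := by
    intro x y h
    obtain ⟨p, hp', hne⟩ := hC.exists_separating h
    exact ⟨_, ⟨e p, ⟨p, hp p hp', rfl⟩, rfl⟩, hne⟩
  -- The image is dense by Stone–Weierstrass, and closed because the Gelfand transform is isometric.
  have h2 := ContinuousMap.starSubalgebra_topologicalClosure_eq_top_of_separatesPoints _ h1
  have h3 : IsClosed ((S.map e.toStarAlgHom :) : Set C(characterSpace ℂ C, ℂ)) := by
    have : Isometry e := gelfandTransform_isometry C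
    rw [StarSubalgebra.coe_map]
    exact this.isClosedEmbedding.isClosedMap _ hS
  rw [eq_top_iff]
  intro c _
  have h4 : e c ∈ (S.map e.toStarAlgHom).topologicalClosure := by rw [h2]; trivial
  rw [← SetLike.mem_coe, StarSubalgebra.topologicalClosure_coe, h3.closure_eq] at h4
  obtain ⟨c', hc', h5⟩ := h4
  rwa [← e.injective h5]

/-- A closed star subalgebra of the codomain containing the images of the projections contains
the range. -/
theorem IsAWStarAlgebra.map_mem_of_projections (hC : IsAWStarAlgebra C) (φ : C →⋆ₐ[ℂ] D)
    {S : StarSubalgebra ℂ D} (hS : IsClosed (S : Set D))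
    (hp : ∀ p, IsStarProjection p → φ p ∈ S) (c : C) : φ c ∈ S := by
  have : S.comap φ = ⊤ := hC.eq_top_of_projections_mem
    (hS.preimage (continuous_starAlgHom φ)) hp
  have h : c ∈ S.comap φ := by rw [this]; trivial
  exact h

/-- Homomorphisms on a commutative AW*-algebra are determined by the projections. -/
theorem IsAWStarAlgebra.hom_ext (hC : IsAWStarAlgebra C) {φ ψ : C →⋆ₐ[ℂ] D}
    (h : ∀ p, IsStarProjection p → φ p = ψ p) : φ = ψ := by
  have : StarAlgHom.equalizer φ ψ = ⊤ := hC.eq_top_of_projections_mem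
    (isClosed_eq (continuous_starAlgHom φ) (continuous_starAlgHom ψ)) h
  ext c
  have h : c ∈ StarAlgHom.equalizer φ ψ := by rw [this]; trivial
  exact h

theorem IsStarProjection.apply_eq_zero_or_one {p : C} (hp : IsStarProjection p)
    (x : characterSpace ℂ C) : x p = 0 ∨ x p = 1 := by
  have h : x p * x p = x p := by rw [← map_mul, hp.isIdempotentElem]
  rcases eq_or_ne (x p) 0 with h0 | h0
  · exact Or.inl h0
  · exact Or.inr (mul_left_cancel₀ h0 (by rw [h, mul_one]))

/-- Given a Boolean homomorphism from the projections of `C` to those of `D`, each character of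
`D` is extended by one of `C`. -/
theorem exists_character_extending {φ : C → D}
    (hφ : ∀ p, IsStarProjection p → IsStarProjection (φ p))
    (hmul : ∀ p q, IsStarProjection p → IsStarProjection q → φ (p * q) = φ p * φ q)
    (hcompl : ∀ p, IsStarProjection p → φ (1 - p) = 1 - φ p) (y : characterSpace ℂ D) :
    ∃ x : characterSpace ℂ C, ∀ p, IsStarProjection p → x p = y (φ p) := by
  -- The ultrafilter of projections induced by `y`. The closed sets `{x | x p = 1}` for `p` in it
  -- are nonempty, as `φ 0 = 0` excludes `p = 0`, and directed under products; compactness provides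
  -- a common point.
  let I := {p : C // IsStarProjection p ∧ y (φ p) = 1}
  have h0 : φ 0 = 0 := by
    have h : φ ((0 : C) * (1 - 0)) = φ 0 * (1 - φ 0) := by
      rw [hmul _ _ (.zero C) (IsStarProjection.zero C).one_sub, hcompl _ (.zero C)]
    rwa [zero_mul, (hφ _ (.zero C)).mul_one_sub_self] at h
  have h1 : φ 1 = 1 := by
    have := hcompl 0 (.zero C)
    rwa [sub_zero, h0, sub_zero] at this
  have : Nonempty I := ⟨1, .one C, by rw [h1, map_one]⟩
  have hcl (i : I) : IsClosed {x : characterSpace ℂ C | x i.1 = 1} :=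
    isClosed_eq (gelfandTransform ℂ C i.1).continuous continuous_const
  have hdir : Directed (· ⊇ ·) (fun i : I => {x : characterSpace ℂ C | x i.1 = 1}) := by
    rintro ⟨p, hp, hp'⟩ ⟨q, hq, hq'⟩
    refine ⟨⟨p * q, hp.mul hq (Commute.all p q), by rw [hmul p q hp hq, map_mul, hp', hq', one_mul]⟩,
      fun x hx => ?_, fun x hx => ?_⟩
    all_goals
      have hx : x (p * q) = 1 := hx
      rw [map_mul] at hx
    · rcases hp.apply_eq_zero_or_one x with h | h
      · simp [h] at hx
      · exact h
    · rcases hq.apply_eq_zero_or_one x with h | h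
      · simp [h] at hx
      · exact h
  have hne (i : I) : {x : characterSpace ℂ C | x i.1 = 1}.Nonempty := by
    obtain ⟨p, hp, hp'⟩ := i
    by_contra! H
    have hp0 : p = 0 := by
      apply (gelfandTransform_isometry C).injective
      ext x
      change x p = x 0
      rw [map_zero]
      refine (hp.apply_eq_zero_or_one x).resolve_right fun h => ?_
      have : x ∈ (∅ : Set (characterSpace ℂ C)) := by rw [← H]; exact h
      exact this
    rw [hp0, h0, map_zero] at hp'
    exact zero_ne_one hp'
  obtain ⟨x, hx⟩ := IsCompact.nonempty_iInter_of_directed_nonempty_isCompact_isClosed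
    _ hdir hne (fun i => (hcl i).isCompact) hcl
  refine ⟨x, fun p hp => ?_⟩
  have hx' (q : C) (hq : IsStarProjection q) (h : y (φ q) = 1) : x q = 1 :=
    Set.mem_iInter.1 hx ⟨q, hq, h⟩
  rcases (hφ p hp).apply_eq_zero_or_one y with h | h
  · have := hx' (1 - p) hp.one_sub (by rw [hcompl p hp, map_sub, map_one, h, sub_zero])
    rw [map_sub, map_one] at this
    rw [h]
    linear_combination -this
  · rw [h, hx' p hp h]

/-- A Boolean homomorphism between the projections extends to the commutative AW*-algebra. -/
theorem IsAWStarAlgebra.exists_extension (hC : IsAWStarAlgebra C) {φ : C → D}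
    (hφ : ∀ p, IsStarProjection p → IsStarProjection (φ p))
    (hmul : ∀ p q, IsStarProjection p → IsStarProjection q → φ (p * q) = φ p * φ q)
    (hcompl : ∀ p, IsStarProjection p → φ (1 - p) = 1 - φ p) :
    ∃ ψ : C →⋆ₐ[ℂ] D, ∀ p, IsStarProjection p → ψ p = φ p := by
  choose g hg using exists_character_extending hφ hmul hcompl
  -- The chosen map `g` of character spaces is not known to be continuous. The elements whose
  -- pullback along it is continuous form a closed star subalgebra containing all projections, hence
  -- are all of `C`.
  let S : StarSubalgebra ℂ C :=
    { carrier := {c | Continuous fun y => g y c}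
      mul_mem' := fun {a b} ha hb => by
        simp only [Set.mem_ofPred_eq, map_mul] at *; exact ha.mul hb
      add_mem' := fun {a b} ha hb => by
        simp only [Set.mem_ofPred_eq, map_add] at *; exact ha.add hb
      algebraMap_mem' := fun r => by
        simp only [Set.mem_ofPred_eq, AlgHomClass.commutes]; exact continuous_const
      star_mem' := fun {a} ha => by
        simp only [Set.mem_ofPred_eq, map_star] at *; exact ha.star }
  have hS : IsClosed (S : Set C) := by
    -- Characters are contractive, so norm limits pull back to uniform limits.
    refine isClosed_of_closure_subset fun c hc => ?_
    refine continuous_of_uniform_approx_of_continuous fun u hu => ?_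
    obtain ⟨ε, hε, h⟩ := Metric.mem_uniformity_dist.1 hu
    obtain ⟨c', hc', hd⟩ := Metric.mem_closure_iff.1 hc ε hε
    refine ⟨_, hc', fun y => h (lt_of_le_of_lt ?_ hd)⟩
    rw [dist_eq_norm, dist_eq_norm, ← map_sub]
    exact NonUnitalStarAlgHom.norm_apply_le (g y) (c - c')
  have hT : S = ⊤ := hC.eq_top_of_projections_mem hS fun p hp => by
    change Continuous fun y => g y p
    simp only [hg _ p hp]
    exact (gelfandTransform ℂ D (φ p)).continuous
  have hcont (c : C) : Continuous fun y => g y c := by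
    have h : c ∈ S := by rw [hT]; trivial
    exact h
  let Ψ : C →⋆ₐ[ℂ] C(characterSpace ℂ D, ℂ) :=
    { toFun := fun c => ⟨fun y => g y c, hcont c⟩
      map_one' := by ext; simp
      map_mul' := fun _ _ => by ext; simp
      map_zero' := by ext; simp
      map_add' := fun _ _ => by ext; simp
      commutes' := fun r => by ext y; exact AlgHomClass.commutes (g y) r
      map_star' := fun c => by ext y; exact map_star (g y) c }
  refine ⟨(gelfandStarTransform D).symm.toStarAlgHom.comp Ψ, fun p hp => ?_⟩
  apply (gelfandStarTransform D).injective
  change gelfandStarTransform D ((gelfandStarTransform D).symm (Ψ p)) = _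
  rw [StarAlgEquiv.apply_symm_apply]
  ext y
  exact hg y p hp

end

/-! # Commeasurable AW*-subalgebras -/

/-- A commeasurable commutative AW*-subalgebra. -/
structure AWSub (A : Type u) [PAWStarData A] where
  carrier : Set A
  str : CommeasurableAWStarSubalgebra carrier

namespace AWSub

section

variable {A : Type u} [PAWStarData A] (T : AWSub A)

/-- The type of elements of a commeasurable AW*-subalgebra. -/
def Elem : Type u := T.carrier

noncomputable instance : CommCStarAlgebra T.Elem := T.str.alg

variable {T}

/-- The underlying element. -/
def Elem.val (x : T.Elem) : A := Subtype.val x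

/-- An element of the subalgebra from an element of the carrier. -/
def el (x : A) (hx : x ∈ T.carrier) : T.Elem := ⟨x, hx⟩

@[simp] theorem val_el (x : A) (hx : x ∈ T.carrier) : (el x hx).val = x := rfl

theorem Elem.val_mem (x : T.Elem) : x.val ∈ T.carrier := Subtype.prop x

theorem Elem.val_injective : Function.Injective (Elem.val : T.Elem → A) := Subtype.val_injective

theorem Elem.comm (x y : T.Elem) : PCStarData.comm x.val y.val :=
  T.str.pairwise_comm _ x.val_mem _ y.val_mem

theorem val_one : (1 : T.Elem).val = PCStarData.one := T.str.coe_one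
theorem val_star (x : T.Elem) : (star x).val = PCStarData.star x.val := T.str.coe_star x
theorem val_smul (z : ℂ) (x : T.Elem) : (z • x).val = PCStarData.smul z x.val := T.str.coe_smul z x
theorem norm_eq (x : T.Elem) : ‖x‖ = PCStarData.norm x.val := T.str.coe_norm x
theorem val_add (x y : T.Elem) : (x + y).val = PCStarData.add x.val y.val (x.comm y) :=
  T.str.coe_add x y _
theorem val_mul (x y : T.Elem) : (x * y).val = PCStarData.mul x.val y.val (x.comm y) :=
  T.str.coe_mul x y _
theorem val_one_sub (x : T.Elem) : (1 - x).val = PiecewiseCStarAlgebra.oneSub x.val :=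
  T.str.coe_oneSub x

theorem isAWStarAlgebra : IsAWStarAlgebra T.Elem := T.str.isAWStar

/-- A projection of the subalgebra as a projection of the piecewise algebra. -/
def toPProj (p : T.Elem) (hp : IsStarProjection p) : PProj A :=
  ⟨p.val, by rw [← val_star, hp.isSelfAdjoint], by rw [← val_mul, hp.isIdempotentElem]⟩

theorem isStarProjection_el (p : PProj A) (hp : p.1 ∈ T.carrier) :
    IsStarProjection (el p.1 hp) where
  isIdempotentElem := Elem.val_injective (by rw [val_mul]; exact p.2.2)
  isSelfAdjoint := Elem.val_injective (by rw [val_star]; exact p.2.1)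

variable (T) in
/-- The projections lying in the subalgebra. -/
def proj : Set (PProj A) := {p | p.1 ∈ T.carrier}

theorem neg_mem_proj {p : PProj A} (hp : p ∈ T.proj) : PProj.neg p ∈ T.proj := by
  have h := (1 - el p.1 hp).val_mem
  rwa [val_one_sub] at h

theorem el_neg {p : PProj A} (hp : p ∈ T.proj) :
    el (PProj.neg p).1 (neg_mem_proj hp) = 1 - el p.1 hp :=
  Elem.val_injective (val_one_sub (el p.1 hp)).symm

theorem pairwise_comm_proj : PairwiseRel PCBData.comm T.proj :=
  fun p hp q hq => T.str.pairwise_comm p.1 hp q.1 hq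

theorem sup_spec {X : Set (PProj A)} (hX : PairwiseRel PCBData.comm X) (h : X ⊆ T.proj) :
    ∃ hs : PCBData.sup X hX ∈ T.proj,
      (∀ p (hp : p ∈ X), el p.1 (h hp) = el p.1 (h hp) * el _ hs) ∧
      ∀ q : T.Elem, IsStarProjection q → (∀ p (hp : p ∈ X), el p.1 (h hp) = el p.1 (h hp) * q) →
        el _ hs = el _ hs * q := by
  obtain ⟨s, hs, _, h1, h2⟩ := T.str.sup_spec X hX h
  have hs' : PCBData.sup X hX ∈ T.proj := by
    change (PAWStarData.sup X hX).1 ∈ T.carrier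
    rw [← hs]; exact Subtype.prop s
  have e : el _ hs' = s := Subtype.ext hs.symm
  rw [← e] at h1 h2
  refine ⟨hs', fun p hp => h1 _ ⟨p, hp, rfl⟩, fun q hq h3 => h2 q hq ?_⟩
  rintro ⟨_, _⟩ ⟨x, hx, rfl⟩
  exact h3 x hx

theorem sup_mem_proj {X : Set (PProj A)} (hX : PairwiseRel PCBData.comm X) (h : X ⊆ T.proj) :
    PCBData.sup X hX ∈ T.proj := (sup_spec hX h).1

/-- The projection `P + Q - P * Q` is an upper bound, so the supremum `S` equals `S * (P + Q - P *
Q)`, which `P = P * S` and `Q = Q * S` reduce to `P + Q - P * Q`. -/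
theorem el_sup_pair {p q : PProj A} (hp : p ∈ T.proj) (hq : q ∈ T.proj)
    (h : PairwiseRel PCBData.comm {p, q}) :
    el (PCBData.sup {p, q} h).1 (sup_mem_proj h (by rintro _ (rfl | rfl) <;> assumption)) =
      el p.1 hp + el q.1 hq - el p.1 hp * el q.1 hq := by
  obtain ⟨hs, h1, h2⟩ := sup_spec h (T := T) (by rintro _ (rfl | rfl) <;> assumption)
  have hp' := isStarProjection_el p hp
  have hq' := isStarProjection_el q hq
  set P := el p.1 hp
  set Q := el q.1 hq
  set S := el _ hs
  have ep : P = P * S := h1 p (by simp)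
  have eq : Q = Q * S := h1 q (by simp)
  have iP : P * P = P := hp'.isIdempotentElem
  have iQ : Q * Q = Q := hq'.isIdempotentElem
  have hr : IsStarProjection (P + Q - P * Q) := by
    have : P + Q - P * Q = 1 - (1 - P) * (1 - Q) := by ring
    rw [this]
    exact (hp'.one_sub.mul hq'.one_sub (Commute.all _ _)).one_sub
  have h3 := h2 _ hr (by
    rintro _ (rfl | rfl)
    · change P = P * _
      linear_combination (Q - 1) * iP
    · change Q = Q * _
      linear_combination (P - 1) * iQ)
  change S = _
  rw [h3]
  linear_combination (Q - 1) * ep - eq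

/-- The complete Boolean algebra of projections of a commeasurable AW*-subalgebra. -/
@[reducible] noncomputable def projCompleteBooleanAlgebra : CompleteBooleanAlgebra T.proj :=
  letI : PartialOrder T.proj :=
    { le := fun p q => el p.1.1 p.2 = el p.1.1 p.2 * el q.1.1 q.2
      le_refl := fun p => (isStarProjection_el p.1 p.2).isIdempotentElem.symm
      le_trans := fun p q r h1 h2 => by
        have h1 : el p.1.1 p.2 = el p.1.1 p.2 * el q.1.1 q.2 := h1
        have h2 : el q.1.1 q.2 = el q.1.1 q.2 * el r.1.1 r.2 := h2
        linear_combination (1 - el r.1.1 r.2) * h1 + el p.1.1 p.2 * h2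
      le_antisymm := fun p q h1 h2 => by
        have h1 : el p.1.1 p.2 = el p.1.1 p.2 * el q.1.1 q.2 := h1
        have h2 : el q.1.1 q.2 = el q.1.1 q.2 * el p.1.1 p.2 := h2
        have h3 : el p.1.1 p.2 = el q.1.1 q.2 := by rw [h1, mul_comm]; exact h2.symm
        exact Subtype.ext (Subtype.ext (congrArg Elem.val h3)) }
  letI : SupSet T.proj := ⟨fun X => ⟨PCBData.sup (Subtype.val '' X)
    (fun p hp q hq => pairwise_comm_proj (T := T) p (by
      obtain ⟨x, _, rfl⟩ := hp; exact x.2) q (by obtain ⟨x, _, rfl⟩ := hq; exact x.2)),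
    sup_mem_proj _ (by rintro _ ⟨x, _, rfl⟩; exact x.2)⟩⟩
  letI : Compl T.proj := ⟨fun p => ⟨PProj.neg p.1, neg_mem_proj p.2⟩⟩
  have hlub : ∀ X : Set T.proj, IsLUB X (sSup X) := fun X => by
    obtain ⟨hs, h1, h2⟩ := sup_spec (T := T) (X := Subtype.val '' X)
      (fun p hp q hq => pairwise_comm_proj (T := T) p (by
        obtain ⟨x, _, rfl⟩ := hp; exact x.2) q (by obtain ⟨x, _, rfl⟩ := hq; exact x.2))
      (by rintro _ ⟨x, _, rfl⟩; exact x.2)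
    refine ⟨fun x hx => h1 x.1 ⟨x, hx, rfl⟩, fun q hq => h2 _ (isStarProjection_el q.1 q.2) ?_⟩
    rintro _ ⟨x, hx, rfl⟩
    exact hq hx
  completeBooleanAlgebraOfSup T.proj hlub
    (fun x z h1 h2 w => by
      have h1 : el z.1.1 z.2 = el z.1.1 z.2 * el x.1.1 x.2 := h1
      have h2 : el z.1.1 z.2 = el z.1.1 z.2 * el (PProj.neg x.1).1 (neg_mem_proj x.2) := h2
      rw [el_neg x.2] at h2
      have h3 : el z.1.1 z.2 = 0 := by linear_combination h1 + h2
      change el z.1.1 z.2 = el z.1.1 z.2 * _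
      rw [h3, zero_mul])
    (fun x z h1 h2 w => by
      have h1 : el x.1.1 x.2 = el x.1.1 x.2 * el z.1.1 z.2 := h1
      have h2 : el (PProj.neg x.1).1 (neg_mem_proj x.2) =
        el (PProj.neg x.1).1 (neg_mem_proj x.2) * el z.1.1 z.2 := h2
      rw [el_neg x.2] at h2
      change el w.1.1 w.2 = el w.1.1 w.2 * el z.1.1 z.2
      linear_combination (el w.1.1 w.2) * (h1 + h2))
    (fun X x u h z h1 h2 => by
      obtain ⟨hs, _, h4⟩ := sup_spec (T := T) (X := Subtype.val '' X)
        (fun p hp q hq => pairwise_comm_proj (T := T) p (by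
          obtain ⟨x, _, rfl⟩ := hp; exact x.2) q (by obtain ⟨x, _, rfl⟩ := hq; exact x.2))
        (by rintro _ ⟨x, _, rfl⟩; exact x.2)
      have hx := isStarProjection_el x.1 x.2
      have hu := isStarProjection_el u.1 u.2
      -- This projection is the Boolean implication from `x` to `u`. It bounds each `y` of `X`
      -- because `x * y` lies below `u`, hence it bounds the supremum.
      have h5 := h4 (1 - el x.1.1 x.2 * (1 - el u.1.1 u.2))
        (hx.mul hu.one_sub (Commute.all _ _)).one_sub (by
          rintro _ ⟨y, hy, rfl⟩
          have hy' := isStarProjection_el y.1 y.2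
          let m := el x.1.1 x.2 * el y.1.1 y.2
          have hm : IsStarProjection m := hx.mul hy' (Commute.all _ _)
          have h6 : m = m * el u.1.1 u.2 := h y hy ⟨toPProj m hm, m.val_mem⟩
            (by
              change m = m * el x.1.1 x.2
              simp only [m]
              linear_combination (-el y.1.1 y.2) * hx.isIdempotentElem.eq)
            (by
              change m = m * el y.1.1 y.2
              simp only [m]
              linear_combination (-el x.1.1 x.2) * hy'.isIdempotentElem.eq)
          simp only [m] at h6
          linear_combination h6)
      have h1 : el z.1.1 z.2 = el z.1.1 z.2 * el x.1.1 x.2 := h1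
      have h2 : el z.1.1 z.2 = el z.1.1 z.2 * el _ hs := h2
      change el z.1.1 z.2 = el z.1.1 z.2 * el u.1.1 u.2
      have h7 : el z.1.1 z.2 = el z.1.1 z.2 * (1 - el x.1.1 x.2 * (1 - el u.1.1 u.2)) := by
        conv_lhs => rw [h2, h5, ← mul_assoc, ← h2]
      linear_combination h7 + (1 - el u.1.1 u.2) * h1)

variable (T) in
/-- The projections of a commeasurable AW*-subalgebra form a commeasurable Boolean subalgebra. -/
noncomputable def projSubalgebra : CommeasurableSubalgebra T.proj where
  pairwise_comm := pairwise_comm_proj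
  alg := projCompleteBooleanAlgebra
  coe_compl _ := rfl
  coe_sSup _ _ := rfl

end

section

variable {A : Type u} [PiecewiseAWStarAlgebra A]

/-- A coherent choice of commeasurable AW*-subalgebras containing given commeasurable sets. -/
noncomputable def hull (S : Set A) (hS : PairwiseRel PCStarData.comm S) : AWSub A :=
  ⟨PiecewiseAWStarAlgebra.exists_subalgebra_mono.choose S hS,
    (PiecewiseAWStarAlgebra.exists_subalgebra_mono.choose_spec.2.1 S hS).some⟩

theorem subset_hull {S : Set A} (hS : PairwiseRel PCStarData.comm S) : S ⊆ (hull S hS).carrier :=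
  PiecewiseAWStarAlgebra.exists_subalgebra_mono.choose_spec.1 S hS

theorem hull_mono {S S' : Set A} (hS : PairwiseRel PCStarData.comm S)
    (hS' : PairwiseRel PCStarData.comm S') (h : S ⊆ S') :
    (hull S hS).carrier ⊆ (hull S' hS').carrier :=
  PiecewiseAWStarAlgebra.exists_subalgebra_mono.choose_spec.2.2 S hS S' hS' h

end

end AWSub

/-- The projections of a piecewise AW*-algebra form a piecewise complete Boolean algebra. -/
instance {A : Type u} [PiecewiseAWStarAlgebra A] : PiecewiseCBA (PProj A) where
  exists_subalgebra S hS := by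
    have hS' : PairwiseRel PCStarData.comm (Subtype.val '' S : Set A) := by
      rintro _ ⟨p, hp, rfl⟩ _ ⟨q, hq, rfl⟩
      exact hS p hp q hq
    exact ⟨(AWSub.hull _ hS').proj, fun p hp => AWSub.subset_hull hS' ⟨p, hp, rfl⟩,
      ⟨AWSub.projSubalgebra _⟩⟩

/-! # The projection functor -/

namespace AWSub

section

variable {A B : Type u} [PAWStarData A] [PAWStarData B]

/-- A function between commeasurable AW*-subalgebras that is compatible with the operations. -/
def starAlgHomOf {T : AWSub A} {U : AWSub B} (f : T.Elem → U.Elem) (h1 : f 1 = 1)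
    (hmul : ∀ x y, f (x * y) = f x * f y) (hadd : ∀ x y, f (x + y) = f x + f y)
    (hsmul : ∀ (z : ℂ) x, f (z • x) = z • f x) (hstar : ∀ x, f (star x) = star (f x)) :
    T.Elem →⋆ₐ[ℂ] U.Elem where
  toFun := f
  map_one' := h1
  map_mul' := hmul
  map_zero' := by rw [← zero_smul ℂ (0 : T.Elem), hsmul, zero_smul]
  map_add' := hadd
  commutes' r := by rw [Algebra.algebraMap_eq_smul_one, hsmul, h1, Algebra.algebraMap_eq_smul_one]
  map_star' := hstar

/-- The restriction of a morphism to commeasurable subalgebras. -/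
def restrict (f : PCStarHom A B) (T : AWSub A) (U : AWSub B)
    (h : ∀ x ∈ T.carrier, f.toFun x ∈ U.carrier) : T.Elem →⋆ₐ[ℂ] U.Elem :=
  starAlgHomOf (fun x => el (f.toFun x.val) (h _ x.val_mem))
    (Elem.val_injective (by rw [val_el, val_one, val_one, f.map_one]))
    (fun x y => Elem.val_injective (by rw [val_el, val_mul, f.map_mul, val_mul]; rfl))
    (fun x y => Elem.val_injective (by rw [val_el, val_add, f.map_add, val_add]; rfl))
    (fun z x => Elem.val_injective (by rw [val_el, val_smul, f.map_smul, val_smul]; rfl))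
    (fun x => Elem.val_injective (by rw [val_el, val_star, f.map_star, val_star]; rfl))

@[simp] theorem val_restrict (f : PCStarHom A B) (T : AWSub A) (U : AWSub B)
    (h : ∀ x ∈ T.carrier, f.toFun x ∈ U.carrier) (x : T.Elem) :
    (restrict f T U h x).val = f.toFun x.val := rfl

/-- The inclusion of commeasurable subalgebras. -/
def inclusion {T U : AWSub A} (h : T.carrier ⊆ U.carrier) : T.Elem →⋆ₐ[ℂ] U.Elem :=
  restrict (PCStarHom.id A) T U h

/-- Norms are computed in the ambient piecewise algebra, so inclusions are isometric and their
ranges complete. -/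
theorem isClosed_range_inclusion {T U : AWSub A} (h : T.carrier ⊆ U.carrier) :
    IsClosed ((inclusion h).range : Set U.Elem) := by
  have : Isometry (inclusion h) := AddMonoidHomClass.isometry_of_norm _ fun x => by
    rw [norm_eq, norm_eq]; rfl
  have h := this.isClosedEmbedding.isClosed_range
  exact h

/-- A morphism sends a commeasurable AW*-subalgebra into any commeasurable AW*-subalgebra which
contains the images of the projections, if that is contained in one for which this holds. -/
theorem map_mem_of_proj (f : PCStarHom A B) (T : AWSub A) {U W : AWSub B}
    (hU : ∀ x ∈ T.carrier, f.toFun x ∈ U.carrier) (hWU : W.carrier ⊆ U.carrier)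
    (hW : ∀ p ∈ T.proj, (f.onProj p).1 ∈ W.carrier) : ∀ x ∈ T.carrier, f.toFun x ∈ W.carrier := by
  intro x hx
  obtain ⟨w, hw⟩ := isAWStarAlgebra.map_mem_of_projections (restrict f T U hU)
    (isClosed_range_inclusion hWU)
    (fun p hp => ⟨el _ (hW (toPProj p hp) p.val_mem), Elem.val_injective rfl⟩) (el x hx)
  have := congrArg Elem.val hw
  rw [val_restrict, val_el] at this
  rw [← this]
  exact w.val_mem

end

/-! ### Unique extension of morphisms from projections -/

section

variable {A B : Type u} [PiecewiseAWStarAlgebra A] [PiecewiseAWStarAlgebra B]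

theorem pairwise_image_val {X : Set (PProj A)} (hX : PairwiseRel PCBData.comm X) :
    PairwiseRel PCStarData.comm (Subtype.val '' X : Set A) := by
  rintro _ ⟨p, hp, rfl⟩ _ ⟨q, hq, rfl⟩
  exact hX p hp q hq

theorem pairwise_singleton (a : A) : PairwiseRel PCStarData.comm {a} := by
  rintro _ rfl _ rfl
  exact PCStarData.comm_refl _

theorem pairwise_pair {a b : A} (h : PCStarData.comm a b) : PairwiseRel PCStarData.comm {a, b} := by
  rintro _ (rfl | rfl) _ (rfl | rfl)
  exacts [PCStarData.comm_refl _, h, PCStarData.comm_symm _ _ h, PCStarData.comm_refl _]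

/-- Morphisms of piecewise AW*-algebras are determined by their values on projections. -/
theorem hom_ext_of_onProj {f g : PCStarHom A B} (h : ∀ p, f.onProj p = g.onProj p) : f = g := by
  refine PCStarHom.ext (funext fun a => ?_)
  let T := hull {a} (pairwise_singleton a)
  have ha : a ∈ T.carrier := subset_hull _ rfl
  -- This set is the same for `g`. Coherence places its hull inside the hull of the image of `T`
  -- under either morphism, so both restrict to maps from `T` into the hull of `Q`, where uniqueness
  -- for commutative algebras applies.
  let Q : Set B := Subtype.val '' (f.onProj '' T.proj)
  have hQ : PairwiseRel PCStarData.comm Q :=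
    pairwise_image_val ((pairwise_comm_proj (T := T)).image f.onProj_comm)
  have hT : PairwiseRel PCStarData.comm T.carrier := T.str.pairwise_comm
  have hW : ∀ p ∈ T.proj, (f.onProj p).1 ∈ (hull Q hQ).carrier := fun p hp =>
    subset_hull hQ ⟨_, ⟨p, hp, rfl⟩, rfl⟩
  have hf := map_mem_of_proj f T (U := hull _ (hT.image f.map_comm)) (W := hull Q hQ)
    (fun x hx => subset_hull _ ⟨x, hx, rfl⟩) (hull_mono _ _ (by
      rintro _ ⟨_, ⟨p, hp, rfl⟩, rfl⟩; exact ⟨p.1, hp, rfl⟩)) hW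
  have hg := map_mem_of_proj g T (U := hull _ (hT.image g.map_comm)) (W := hull Q hQ)
    (fun x hx => subset_hull _ ⟨x, hx, rfl⟩) (hull_mono _ _ (by
      rintro _ ⟨_, ⟨p, hp, rfl⟩, rfl⟩; rw [h]; exact ⟨p.1, hp, rfl⟩))
      (fun p hp => h p ▸ hW p hp)
  have := isAWStarAlgebra.hom_ext (φ := restrict f T _ hf) (ψ := restrict g T _ hg)
    fun p hp => Elem.val_injective
      (show f.toFun p.val = g.toFun p.val from congrArg Subtype.val (h (toPProj p hp)))
  exact congrArg Elem.val (DFunLike.congr_fun this (el a ha))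

/-- De Morgan expresses products of projections by negations and suprema, which morphisms of
piecewise Boolean algebras preserve. -/
theorem oneSub_oneSub_mul {T : AWSub A} {p q : PProj A} (hp : p ∈ T.proj) (hq : q ∈ T.proj)
    (h : PairwiseRel PCBData.comm {PCBData.neg p, PCBData.neg q}) :
    (PCBData.neg (PCBData.sup {PCBData.neg p, PCBData.neg q} h)).1 =
      (el p.1 hp * el q.1 hq : T.Elem).val := by
  have hs := sup_mem_proj (T := T) h (by
    rintro _ (rfl | rfl)
    exacts [neg_mem_proj hp, neg_mem_proj hq])
  have h1 := el_sup_pair (neg_mem_proj hp) (neg_mem_proj hq) h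
  have h2 := congrArg Elem.val (el_neg hs)
  refine h2.trans (congrArg Elem.val ?_)
  rw [el_neg hp, el_neg hq] at h1
  refine (congrArg (1 - ·) h1).trans ?_
  ring

variable (f : PCBHom (PProj A) (PProj B))

/-- The images of the projections of a subalgebra under a morphism of projections. -/
def imageProj (T : AWSub A) : Set B := Subtype.val '' (f.toFun '' T.proj)

theorem pairwise_imageProj (T : AWSub A) : PairwiseRel PCStarData.comm (imageProj f T) :=
  pairwise_image_val ((pairwise_comm_proj (T := T)).image f.map_comm)

theorem exists_extension (T : AWSub A) :
    ∃ ψ : T.Elem →⋆ₐ[ℂ] (hull _ (pairwise_imageProj f T)).Elem,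
      ∀ p hp, (ψ p).val = (f.toFun (toPProj p hp)).1 := by
  classical
  let U := hull _ (pairwise_imageProj f T)
  have hU (p : PProj A) (hp : p ∈ T.proj) : f.toFun p ∈ U.proj :=
    subset_hull (pairwise_imageProj f T) ⟨_, ⟨p, hp, rfl⟩, rfl⟩
  -- Only values on projections matter; elsewhere the value is arbitrarily `0`.
  let φ (p : T.Elem) : U.Elem :=
    if hp : IsStarProjection p then el _ (hU (toPProj p hp) p.val_mem) else 0
  have hφ (p : T.Elem) (hp : IsStarProjection p) : φ p = el _ (hU (toPProj p hp) p.val_mem) :=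
    dif_pos hp
  have hmul (p q : T.Elem) (hp : IsStarProjection p) (hq : IsStarProjection q) :
      φ (p * q) = φ p * φ q := by
    have hpq := hp.mul hq (Commute.all p q)
    have hT : PairwiseRel PCBData.comm
        {PCBData.neg (toPProj p hp), PCBData.neg (toPProj q hq)} := fun a ha b hb =>
      pairwise_comm_proj (T := T) a (by
        rcases ha with rfl | rfl <;> exact neg_mem_proj (Elem.val_mem _)) b (by
        rcases hb with rfl | rfl <;> exact neg_mem_proj (Elem.val_mem _))
    have e1 : toPProj (p * q) hpq = PCBData.neg (PCBData.sup _ hT) :=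
      Subtype.ext (oneSub_oneSub_mul (T := T) p.val_mem q.val_mem hT).symm
    have hU1 := hU (toPProj p hp) p.val_mem
    have hU2 := hU (toPProj q hq) q.val_mem
    have e2 : f.toFun '' {PCBData.neg (toPProj p hp), PCBData.neg (toPProj q hq)} =
        {PCBData.neg (f.toFun (toPProj p hp)), PCBData.neg (f.toFun (toPProj q hq))} := by
      rw [Set.image_pair, f.map_neg, f.map_neg]
    rw [hφ _ hp, hφ _ hq, hφ _ hpq]
    refine Elem.val_injective ?_
    rw [← oneSub_oneSub_mul hU1 hU2 (e2 ▸ hT.image f.map_comm)]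
    change (f.toFun (toPProj (p * q) hpq)).1 = _
    rw [e1, f.map_neg, f.map_sup]
    exact congrArg (fun x => (PCBData.neg x).1) (PCBData.sup_congr e2 _ _)
  have hcompl (p : T.Elem) (hp : IsStarProjection p) : φ (1 - p) = 1 - φ p := by
    have e : toPProj (1 - p) hp.one_sub = PCBData.neg (toPProj p hp) :=
      Subtype.ext (val_one_sub p)
    rw [hφ _ hp, hφ _ hp.one_sub]
    refine Elem.val_injective ?_
    rw [val_one_sub]
    change (f.toFun (toPProj (1 - p) hp.one_sub)).1 = _
    rw [e, f.map_neg]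
    rfl
  obtain ⟨ψ, hψ⟩ := isAWStarAlgebra.exists_extension (φ := φ) (fun p hp => by
    rw [hφ p hp]; exact isStarProjection_el _ _) hmul hcompl
  exact ⟨ψ, fun p hp => by rw [hψ p hp, hφ p hp]; rfl⟩

/-- The extension of a morphism of projections to a commeasurable subalgebra. -/
noncomputable def extension (T : AWSub A) :
    T.Elem →⋆ₐ[ℂ] (hull _ (pairwise_imageProj f T)).Elem := (exists_extension f T).choose

theorem val_extension_of_isStarProjection {T : AWSub A} {p : T.Elem} (hp : IsStarProjection p) :
    (extension f T p).val = (f.toFun (toPProj p hp)).1 := (exists_extension f T).choose_spec p hp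

/-- By coherence the target for `T` embeds in that for `T'`. Both routes from `T` into the latter
agree on projections, hence everywhere. -/
theorem val_extension_of_subset {T T' : AWSub A} (h : T.carrier ⊆ T'.carrier) {x : A}
    (hx : x ∈ T.carrier) : (extension f T (el x hx)).val = (extension f T' (el x (h hx))).val := by
  have hU : (hull _ (pairwise_imageProj f T)).carrier ⊆
      (hull _ (pairwise_imageProj f T')).carrier :=
    hull_mono _ _ (Set.image_mono (Set.image_mono fun p hp => h hp))
  have := isAWStarAlgebra.hom_ext (φ := (inclusion hU).comp (extension f T))
    (ψ := (extension f T').comp (inclusion h)) fun p hp => Elem.val_injective (by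
      have hp' : IsStarProjection (inclusion h p) := hp.map (inclusion h)
      exact (val_extension_of_isStarProjection f hp).trans
        (val_extension_of_isStarProjection f hp').symm)
  exact congrArg Elem.val (DFunLike.congr_fun this (el x hx))

/-- The extension of a morphism of projections, as a function. -/
noncomputable def extendFun (a : A) : B :=
  (extension f (hull {a} (pairwise_singleton a)) (el a (subset_hull _ rfl))).val

/-- Coherence does not place `hull {a}` inside `hull S` when `a` is not in `S` itself, but both lie
in the hull of the carrier of `hull S`. -/
theorem extendFun_of_mem {S : Set A} (hS : PairwiseRel PCStarData.comm S) {a : A}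
    (ha : a ∈ (hull S hS).carrier) : extendFun f a = (extension f (hull S hS) (el a ha)).val := by
  have hS' : PairwiseRel PCStarData.comm (hull S hS).carrier := (hull S hS).str.pairwise_comm
  unfold extendFun
  rw [val_extension_of_subset f (T' := hull _ hS') (hull_mono _ _ (by simpa using ha)),
    val_extension_of_subset f (T := hull S hS) (T' := hull _ hS') (hull_mono _ _ (subset_hull hS))]

/-- The extension of a morphism of projections to the piecewise AW*-algebra. -/
noncomputable def extend : PCStarHom A B :=
  -- Here and below, the elements involved lie in the hull of one commeasurable set, on which
  -- `extendFun` is a star homomorphism.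
  have hcomm (a b : A) (h : PCStarData.comm a b) :
      PCStarData.comm (extendFun f a) (extendFun f b) := by
    rw [extendFun_of_mem f (pairwise_pair h) (subset_hull _ (by simp)),
      extendFun_of_mem f (pairwise_pair h) (subset_hull _ (by simp))]
    exact Elem.comm _ _
  { toFun := extendFun f
    map_comm := hcomm
    map_one := by
      have h := pairwise_singleton (PCStarData.one : A)
      have e : el PCStarData.one (subset_hull h rfl) = 1 := Elem.val_injective val_one.symm
      rw [extendFun_of_mem f h (subset_hull _ rfl), e, map_one, val_one]
    map_mul := fun a b h => by
      have hS := pairwise_pair h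
      have ha := subset_hull hS (show a ∈ _ by simp)
      have hb := subset_hull hS (show b ∈ _ by simp)
      have e : PCStarData.mul a b h = (el a ha * el b hb).val := (val_mul (el a ha) (el b hb)).symm
      have h1 := extendFun_of_mem f hS ha
      have h2 := extendFun_of_mem f hS hb
      have h3 := extendFun_of_mem f hS (el a ha * el b hb).val_mem
      simp only [e, h1, h2, h3]
      rw [← val_mul, ← map_mul]
      rfl
    map_add := fun a b h => by
      have hS := pairwise_pair h
      have ha := subset_hull hS (show a ∈ _ by simp)
      have hb := subset_hull hS (show b ∈ _ by simp)
      have e : PCStarData.add a b h = (el a ha + el b hb).val := (val_add (el a ha) (el b hb)).symm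
      have h1 := extendFun_of_mem f hS ha
      have h2 := extendFun_of_mem f hS hb
      have h3 := extendFun_of_mem f hS (el a ha + el b hb).val_mem
      simp only [e, h1, h2, h3]
      rw [← val_add, ← map_add]
      rfl
    map_smul := fun z a => by
      have hS := pairwise_singleton a
      have ha := subset_hull hS rfl
      have e : PCStarData.smul z a = (z • el a ha).val := (val_smul z (el a ha)).symm
      rw [e, extendFun_of_mem f hS ha, extendFun_of_mem f hS (z • el a ha).val_mem, ← val_smul,
        ← map_smul]
      rfl
    map_star := fun a => by
      have hS := pairwise_singleton a
      have ha := subset_hull hS rfl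
      have e : PCStarData.star a = (star (el a ha)).val := (val_star (el a ha)).symm
      rw [e, extendFun_of_mem f hS ha, extendFun_of_mem f hS (star (el a ha)).val_mem, ← val_star,
        ← map_star]
      rfl }

theorem extend_onProj (p : PProj A) : (extend f).onProj p = f.toFun p :=
  Subtype.ext (val_extension_of_isStarProjection f 
    (isStarProjection_el p (subset_hull (pairwise_singleton p.1) rfl)))

end

end AWSub

theorem PCStarHom.onProj_neg {A B : Type u} [PiecewiseCStarAlgebra A] [PiecewiseCStarAlgebra B]
    (f : PCStarHom A B) (p : PProj A) : f.onProj p.neg = (f.onProj p).neg := by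
  refine Subtype.ext ?_
  change f.toFun (PCStarData.add _ _ _) = PCStarData.add _ _ _
  rw [f.map_add]
  congr 1
  · exact f.map_one
  · exact f.map_smul _ _

/-- The projections of a transitive joined piecewise AW*-algebra. -/
@[reducible] def TJPAWStar.proj (A : TJPAWStar.{u}) : TJPCBoolean.{u} where
  obj := ⟨PProj A.obj.carrier⟩
  transitive := A.transitive
  joined := A.joined

/-- The projection functor. -/
def projFunctor : TJPAWStar.{u} ⥤ TJPCBoolean.{u} where
  obj A := A.proj
  map f :=
    ⟨{ toFun := (PAWStarHom.toPCStarHom f.1).onProj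
       map_comm := (PAWStarHom.toPCStarHom f.1).onProj_comm
       map_neg := (PAWStarHom.toPCStarHom f.1).onProj_neg
       map_sup := PAWStarHom.map_sup f.1 }, f.2⟩

instance : projFunctor.{u}.Faithful where
  map_injective h := Subtype.ext (PAWStarHom.ext (congrArg PCStarHom.toFun
    (AWSub.hom_ext_of_onProj fun p => congrFun (congrArg (fun k => PCBHom.toFun k.1) h) p)))

instance : projFunctor.{u}.Full where
  map_surjective {A B} f := by
    let g : PCBHom (PProj A.obj.carrier) (PProj B.obj.carrier) := f.1
    have e : (AWSub.extend g).onProj = g.toFun := funext (AWSub.extend_onProj g)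
    refine ⟨⟨({ AWSub.extend g with
      map_sup := fun X hX => ?_ } : PAWStarHom A.obj.carrier B.obj.carrier), ?_⟩,
      Subtype.ext (PCBHom.ext e)⟩
    · refine (AWSub.extend_onProj g _).trans ((g.map_sup X hX).trans ?_)
      exact PCBData.sup_congr (congrArg (· '' X) e.symm) _ _
    · change PreservesBinaryJoins (AWSub.extend g).onProj
      rw [e]
      exact f.2

/-! # The Stone space of a Boolean subset of an orthomodular lattice -/

namespace CompleteOrthomodularLattice

variable {P : Type u} [CompleteOrthomodularLattice P]

/-- The Stone space of a Boolean subset: two-valued homomorphisms, extended by `false`. -/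
def StoneSpace (R : Set P) : Type u :=
  {x : P → Bool // (∀ p ∉ R, x p = false) ∧ x ⊥ = false ∧
    (∀ p ∈ R, ∀ q ∈ R, x (p ⊔ q) = (x p || x q)) ∧ ∀ p ∈ R, x pᶜ = !(x p)}

namespace StoneSpace

variable {R : Set P}

instance : TopologicalSpace (StoneSpace R) := inferInstanceAs (TopologicalSpace (Subtype _))

instance : T2Space (StoneSpace R) := inferInstanceAs (T2Space (Subtype _))

/-- The defining conditions are closed in the compact product `P → Bool`. -/
instance : CompactSpace (StoneSpace R) := by
  have h (p : P) : Continuous fun x : P → Bool => x p := continuous_apply p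
  have hnot : Continuous fun b : Bool => !b := continuous_of_discreteTopology
  have hor : Continuous fun b : Bool × Bool => (b.1 || b.2) := continuous_of_discreteTopology
  have e : {x : P → Bool | (∀ p ∉ R, x p = false) ∧ x ⊥ = false ∧
      (∀ p ∈ R, ∀ q ∈ R, x (p ⊔ q) = (x p || x q)) ∧ ∀ p ∈ R, x pᶜ = !(x p)} =
      (⋂ p ∈ Rᶜ, {x | x p = false}) ∩ ({x | x ⊥ = false} ∩
        ((⋂ p ∈ R, ⋂ q ∈ R, {x | x (p ⊔ q) = (x p || x q)}) ∩ ⋂ p ∈ R, {x | x pᶜ = !(x p)})) := by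
    ext; simp
  refine isCompact_iff_compactSpace.1 (IsClosed.isCompact (s := {x : P → Bool | _}) ?_)
  rw [e]
  refine IsClosed.inter ?_ (IsClosed.inter ?_ (IsClosed.inter ?_ ?_))
  · exact isClosed_biInter fun p _ => isClosed_eq (h p) continuous_const
  · exact isClosed_eq (h _) continuous_const
  · exact isClosed_biInter fun p _ => isClosed_biInter fun q _ =>
      isClosed_eq (h _) (hor.comp ((h p).prodMk (h q)))
  · exact isClosed_biInter fun p _ => isClosed_eq (h _) (hnot.comp (h p))

/-- Evaluation at an element. -/
def holds (x : StoneSpace R) (p : P) : Prop := x.1 p = true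

theorem ext {x y : StoneSpace R} (h : ∀ p ∈ R, x.holds p ↔ y.holds p) : x = y := by
  refine Subtype.ext (funext fun p => ?_)
  by_cases hp : p ∈ R
  · exact Bool.eq_iff_iff.2 (h p hp)
  · rw [x.2.1 p hp, y.2.1 p hp]

theorem not_holds_bot (x : StoneSpace R) : ¬ x.holds ⊥ := by
  unfold holds; simp [x.2.2.1]

theorem holds_sup (x : StoneSpace R) {p q : P} (hp : p ∈ R) (hq : q ∈ R) :
    x.holds (p ⊔ q) ↔ x.holds p ∨ x.holds q := by
  unfold holds; simp [x.2.2.2.1 p hp q hq]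

theorem holds_compl (x : StoneSpace R) {p : P} (hp : p ∈ R) : x.holds pᶜ ↔ ¬ x.holds p := by
  unfold holds; simp [x.2.2.2.2 p hp]

theorem holds_mono (x : StoneSpace R) {p q : P} (hp : p ∈ R) (hq : q ∈ R) (h : p ≤ q)
    (hx : x.holds p) : x.holds q := by
  rw [← sup_eq_right.2 h, x.holds_sup hp hq]
  exact Or.inl hx

section

variable (hR : IsBooleanSubset R)
include hR

theorem holds_inf (x : StoneSpace R) {p q : P} (hp : p ∈ R) (hq : q ∈ R) :
    x.holds (p ⊓ q) ↔ x.holds p ∧ x.holds q := by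
  rw [← compl_invol (p ⊓ q), compl_inf, x.holds_compl (hR.sup_mem (hR.compl_mem hp) (hR.compl_mem hq)),
    x.holds_sup (hR.compl_mem hp) (hR.compl_mem hq), x.holds_compl hp, x.holds_compl hq]
  tauto

/-- The Boolean prime ideal theorem: a filter base not containing `⊥` is contained in an
ultrafilter. -/
theorem exists_forall_holds {S : Set P} (hS : S ⊆ R) (hne : S.Nonempty) (hbot : ⊥ ∉ S)
    (hinf : ∀ p ∈ S, ∀ q ∈ S, p ⊓ q ∈ S) : ∃ x : StoneSpace R, ∀ p ∈ S, x.holds p := by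
  classical
  let _ := hR.completeBooleanAlgebra
  have hF : Order.IsPFilter {q : R | ∃ p ∈ S, p ≤ q.1} := by
    refine .of_def ?_ ?_ ?_
    · obtain ⟨p, hp⟩ := hne
      exact ⟨⟨p, hS hp⟩, p, hp, le_rfl⟩
    · rintro a ⟨p, hp, hpa⟩ b ⟨q, hq, hqb⟩
      exact ⟨⟨p ⊓ q, hS (hinf p hp q hq)⟩, ⟨_, hinf p hp q hq, le_rfl⟩,
        inf_le_left.trans hpa, inf_le_right.trans hqb⟩
    · rintro a b hab ⟨p, hp, hpa⟩
      exact ⟨p, hp, hpa.trans hab⟩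
  have hb : (⊥ : R).1 = ⊥ := le_bot_iff.1 (bot_le : (⊥ : R) ≤ ⟨⊥, hR.bot_mem⟩)
  obtain ⟨J, hJ, _, hd⟩ := DistribLattice.prime_ideal_of_disjoint_filter_ideal
    (F := hF.toPFilter) (I := Order.Ideal.principal ⊥) (by
      rw [Set.disjoint_left]
      rintro a ⟨p, hp, hpa⟩ ha
      have ha : a.1 ≤ (⊥ : R).1 := ha
      have := hpa.trans ha
      rw [hb, le_bot_iff] at this
      exact hbot (this ▸ hp))
  have hsup (p q : R) : (⟨p.1 ⊔ q.1, hR.sup_mem p.2 q.2⟩ : R) = p ⊔ q :=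
    le_antisymm (sup_le (α := P) (le_sup_left : p ≤ p ⊔ q) (le_sup_right : q ≤ p ⊔ q))
      (sup_le (le_sup_left (α := P) : p.1 ≤ p.1 ⊔ q.1) (le_sup_right (α := P) : q.1 ≤ p.1 ⊔ q.1))
  have hcompl (p : R) : pᶜ ∈ J ↔ p ∉ J :=
    ⟨fun h h' => hJ.toIsProper.top_notMem (by
      rw [← sup_compl_eq_top (x := p)]; exact Order.Ideal.sup_mem h' h),
      fun h => hJ.mem_or_compl_mem.resolve_left h⟩
  -- The ultrafilter is the complement of the prime ideal `J`.
  refine ⟨⟨fun p => if hp : p ∈ R then !decide ((⟨p, hp⟩ : R) ∈ J) else false, ?_, ?_, ?_, ?_⟩, ?_⟩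
  · intro p hp
    simp [hp]
  · simp [hR.bot_mem]
  · intro p hp q hq
    have := hsup ⟨p, hp⟩ ⟨q, hq⟩
    simp only [] at this
    simp only [hp, hq, hR.sup_mem hp hq, dif_pos, this, Order.Ideal.sup_mem_iff]
    simp only [Bool.decide_and, Bool.not_and]
  · intro p hp
    have : (⟨pᶜ, hR.compl_mem hp⟩ : R) ∈ J ↔ _ := hcompl ⟨p, hp⟩
    simp only [hp, hR.compl_mem hp, dif_pos, this]
    simp
  · intro p hp
    have : (⟨p, hS hp⟩ : R) ∉ J := fun h => Set.disjoint_left.1 hd ⟨p, hp, le_rfl⟩ h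
    simp [holds, hS hp, this]

theorem exists_holds {p : P} (hp : p ∈ R) (h0 : p ≠ ⊥) : ∃ x : StoneSpace R, x.holds p := by
  obtain ⟨x, hx⟩ := exists_forall_holds hR (S := {p}) (by simpa) (by simp) (by simpa using h0.symm)
    (by simp)
  exact ⟨x, hx p rfl⟩

/-- A point at which `p ⊓ qᶜ` holds would contradict the hypothesis, so this meet is `⊥`. That alone
does not give `p ≤ q` in an orthomodular lattice; commutation within `R` does. -/
theorem le_of_forall_holds {p q : P} (hp : p ∈ R) (hq : q ∈ R)
    (h : ∀ x : StoneSpace R, x.holds p → x.holds q) : p ≤ q := by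
  have h0 : p ⊓ qᶜ = ⊥ := by
    by_contra h0
    obtain ⟨x, hx⟩ := exists_holds hR (hR.inf_mem hp (hR.compl_mem hq)) h0
    rw [x.holds_inf hR hp (hR.compl_mem hq), x.holds_compl hq] at hx
    exact hx.2 (h x hx.1)
  simpa [compl_invol] using (hR.commutes p hp _ (hR.compl_mem hq)).le_compl h0

/-- The sets of points at which an element holds form a basis. -/
theorem exists_holds_subset {U : Set (StoneSpace R)} (hU : IsOpen U) {x : StoneSpace R}
    (hx : x ∈ U) : ∃ p ∈ R, x.holds p ∧ ∀ y : StoneSpace R, y.holds p → y ∈ U := by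
  classical
  obtain ⟨V, hV, rfl⟩ := hU
  obtain ⟨I, v, hv, hvV⟩ := isOpen_pi_iff.1 hV x.1 hx
  -- A neighbourhood constrains finitely many coordinates. One in `R` is fixed by meeting with `i`
  -- or `iᶜ`; one outside `R` is always `false`.
  suffices H : ∀ I : Finset P, ∃ p ∈ R, x.holds p ∧
      ∀ y : StoneSpace R, y.holds p → ∀ i ∈ I, y.1 i = x.1 i by
    obtain ⟨p, hp, hxp, h⟩ := H I
    refine ⟨p, hp, hxp, fun y hy => hvV fun i hi => ?_⟩
    rw [h y hy i hi]
    exact (hv i hi).2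
  intro I
  induction I using Finset.induction_on with
  | empty =>
    refine ⟨⊤, hR.top_mem, ?_, by simp⟩
    rw [← compl_bot, x.holds_compl hR.bot_mem]
    exact x.not_holds_bot
  | insert i I _ ih =>
    obtain ⟨p, hp, hxp, h⟩ := ih
    by_cases hi : i ∈ R
    · by_cases hxi : x.holds i
      · refine ⟨p ⊓ i, hR.inf_mem hp hi, (x.holds_inf hR hp hi).2 ⟨hxp, hxi⟩, fun y hy j hj => ?_⟩
        rw [y.holds_inf hR hp hi] at hy
        rcases Finset.mem_insert.1 hj with rfl | hj
        · exact hy.2.trans hxi.symm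
        · exact h y hy.1 j hj
      · refine ⟨p ⊓ iᶜ, hR.inf_mem hp (hR.compl_mem hi), (x.holds_inf hR hp (hR.compl_mem hi)).2
          ⟨hxp, (x.holds_compl hi).2 hxi⟩, fun y hy j hj => ?_⟩
        rw [y.holds_inf hR hp (hR.compl_mem hi), y.holds_compl hi] at hy
        rcases Finset.mem_insert.1 hj with rfl | hj
        · unfold holds at hy hxi
          rw [Bool.eq_false_of_not_eq_true hy.2, Bool.eq_false_of_not_eq_true hxi]
        · exact h y hy.1 j hj
    · refine ⟨p, hp, hxp, fun y hy j hj => ?_⟩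
      rcases Finset.mem_insert.1 hj with rfl | hj
      · rw [y.2.1 _ hi, x.2.1 _ hi]
      · exact h y hy j hj

end

/-- The largest element of the Boolean subset holding only at points of `U`. -/
def clopenHull (U : Set (StoneSpace R)) : P :=
  sSup {p | p ∈ R ∧ ∀ x : StoneSpace R, x.holds p → x ∈ U}

section

variable (hR : IsBooleanSubset R)
include hR

theorem clopenHull_mem (U : Set (StoneSpace R)) : clopenHull U ∈ R :=
  hR.sSup_mem fun _ hp => hp.1

theorem holds_clopenHull {U : Set (StoneSpace R)} (hU : IsOpen U) {x : StoneSpace R} (hx : x ∈ U) :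
    x.holds (clopenHull U) := by
  obtain ⟨p, hp, hxp, h⟩ := exists_holds_subset hR hU hx
  exact x.holds_mono hp (clopenHull_mem hR U) (le_sSup ⟨hp, h⟩) hxp

theorem clopenHull_le {U : Set (StoneSpace R)} {p : P} (hp : p ∈ R)
    (h : ∀ x ∈ U, x.holds p) : clopenHull U ≤ p :=
  sSup_le fun _ hq => le_of_forall_holds hR hq.1 hp fun x hx => h x (hq.2 x hx)

/-- A basic `p` inside `V` has a complement holding on `U`, hence lying above the hull. With
`holds_clopenHull` this shows that the hull of an open set holds exactly on its closure: the Stone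
space is extremally disconnected. -/
theorem not_holds_clopenHull {U V : Set (StoneSpace R)} (hV : IsOpen V) (hUV : Disjoint U V)
    {x : StoneSpace R} (hx : x ∈ V) : ¬ x.holds (clopenHull U) := by
  obtain ⟨p, hp, hxp, h⟩ := exists_holds_subset hR hV hx
  intro hxU
  have hle : clopenHull U ≤ pᶜ := clopenHull_le hR (hR.compl_mem hp) fun y hy =>
    (y.holds_compl hp).2 fun hyp => Set.disjoint_left.1 hUV hy (h y hyp)
  exact (x.holds_compl hp).1 (x.holds_mono (clopenHull_mem hR U) (hR.compl_mem hp) hle hxU) hxp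

end

/-! ### Restriction -/

section

variable {R' : Set P}

open Classical in
/-- Restriction of points to a smaller Boolean subset. -/
noncomputable def res (hR : IsBooleanSubset R) (h : R ⊆ R') : C(StoneSpace R', StoneSpace R) where
  toFun x := ⟨fun p => if p ∈ R then x.1 p else false, fun p hp => by simp [hp],
    by simp [x.2.2.1],
    fun p hp q hq => by simp [hp, hq, hR.sup_mem hp hq, x.2.2.2.1 p (h hp) q (h hq)],
    fun p hp => by simp [hp, hR.compl_mem hp, x.2.2.2.2 p (h hp)]⟩
  continuous_toFun := by
    refine Continuous.subtype_mk (continuous_pi fun p => ?_) _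
    split_ifs
    · exact (continuous_apply p).comp continuous_subtype_val
    · exact continuous_const

variable (hR : IsBooleanSubset R) (hR' : IsBooleanSubset R')

@[simp] theorem holds_res (h : R ⊆ R') (x : StoneSpace R') {p : P} (hp : p ∈ R) :
    (res hR h x).holds p ↔ x.holds p := by
  classical
  change (if p ∈ R then x.1 p else false) = true ↔ _
  rw [if_pos hp]
  rfl

include hR' in
-- The elements of `R` holding at `y` form a filter base in `R'`. An ultrafilter of `R'` containing
-- it restricts to `y`, because it also contains the complements of the elements not holding at `y`.
theorem res_surjective (h : R ⊆ R') : Function.Surjective (res hR h) := by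
  intro y
  obtain ⟨x, hx⟩ := exists_forall_holds hR' (S := {p | p ∈ R ∧ y.holds p})
    (fun p hp => h hp.1) ⟨⊤, hR.top_mem, by
      rw [← compl_bot, y.holds_compl hR.bot_mem]; exact y.not_holds_bot⟩
    (fun hb => y.not_holds_bot hb.2)
    (fun p hp q hq => ⟨hR.inf_mem hp.1 hq.1, (y.holds_inf hR hp.1 hq.1).2 ⟨hp.2, hq.2⟩⟩)
  refine ⟨x, ext fun p hp => ?_⟩
  rw [holds_res hR h x hp]
  refine ⟨fun hxp => ?_, fun hyp => hx p ⟨hp, hyp⟩⟩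
  by_contra hyp
  exact (x.holds_compl (h hp)).1
    (hx pᶜ ⟨hR.compl_mem hp, (y.holds_compl hp).2 hyp⟩) hxp

end

/-! ### Spectral families of continuous functions -/

/-- The spectral family of a continuous function: the values at balls in the plane. -/
def spec (a : C(StoneSpace R, ℂ)) (z : ℂ) (ε : ℝ) : P := clopenHull (a ⁻¹' Metric.ball z ε)

section

variable (hR : IsBooleanSubset R)

include hR

theorem spec_mem (a : C(StoneSpace R, ℂ)) (z : ℂ) (ε : ℝ) : spec a z ε ∈ R := clopenHull_mem hR _

theorem holds_spec {a : C(StoneSpace R, ℂ)} {z : ℂ} {ε : ℝ} {x : StoneSpace R}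
    (h : dist (a x) z < ε) : x.holds (spec a z ε) :=
  holds_clopenHull hR (Metric.isOpen_ball.preimage a.continuous) h

/-- The hull is a closure and may reach the boundary of the ball, so the inequality is not strict.
-/
theorem dist_le_of_holds_spec {a : C(StoneSpace R, ℂ)} {z : ℂ} {ε : ℝ} {x : StoneSpace R}
    (h : x.holds (spec a z ε)) : dist (a x) z ≤ ε := by
  by_contra! H
  refine not_holds_clopenHull hR (V := a ⁻¹' (Metric.closedBall z ε)ᶜ)
    (Metric.isClosed_closedBall.isOpen_compl.preimage a.continuous) ?_ ?_ h
  · refine Disjoint.preimage _ ?_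
    exact Set.disjoint_compl_right_iff_subset.2 Metric.ball_subset_closedBall
  · simpa using H

/-- Points identified by all values of the spectral family have the same value. -/
theorem apply_eq_of_spec {a : C(StoneSpace R, ℂ)} {R' : Set P} (hR' : IsBooleanSubset R')
    {b : C(StoneSpace R', ℂ)} {x : StoneSpace R} {y : StoneSpace R'}
    (h : ∀ z ε, x.holds (spec a z ε) → y.holds (spec b z ε)) : a x = b y := by
  by_contra hne
  have hd : 0 < dist (a x) (b y) := dist_pos.2 hne
  have h1 := h (a x) (dist (a x) (b y) / 2) (holds_spec hR (by rw [dist_self]; positivity))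
  have h2 := dist_le_of_holds_spec hR' h1
  rw [dist_comm] at h2
  linarith

theorem spec_injective : Function.Injective (spec : C(StoneSpace R, ℂ) → ℂ → ℝ → P) := by
  intro a b h
  ext x
  exact apply_eq_of_spec hR hR fun z ε hx => h ▸ hx

/-- Spectral families do not change when `R` is enlarged: the value over `R` still holds on the
preimage of the ball, and every element of `R` admissible in its definition stays admissible over
`R'`. -/
theorem spec_comp_res {R' : Set P} (hR' : IsBooleanSubset R') (h : R ⊆ R')
    (a : C(StoneSpace R, ℂ)) : spec (a.comp (res hR h)) = spec a := by
  funext z ε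
  refine le_antisymm ?_ ?_
  · refine clopenHull_le hR' (h (spec_mem hR a z ε)) fun x hx => ?_
    exact (holds_res hR h x (spec_mem hR a z ε)).1 (holds_spec hR hx)
  · refine sSup_le fun p hp => le_sSup ⟨h hp.1, fun x hx => ?_⟩
    exact hp.2 _ ((holds_res hR h x hp.1).2 hx)

/-- A function whose spectral family lies in a smaller Boolean subset comes from that subset. -/
theorem exists_comp_res {R' : Set P} (hR' : IsBooleanSubset R') (h : R ⊆ R')
    (b : C(StoneSpace R', ℂ)) (hb : ∀ z ε, spec b z ε ∈ R) :
    ∃ a : C(StoneSpace R, ℂ), a.comp (res hR h) = b := by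
  -- Points with the same restriction agree on the spectral values of `b`, as these lie in `R`. So
  -- `b` is constant on fibres and descends along the quotient map.
  have hq : Topology.IsQuotientMap (res hR h) :=
    (res hR h).continuous.isClosedMap.isQuotientMap (res hR h).continuous
      (res_surjective hR hR' h)
  refine ⟨hq.lift b fun x y hxy => apply_eq_of_spec hR' hR' fun z ε hx => ?_, hq.lift_comp _ _⟩
  rw [← holds_res hR h y (hb z ε), ← hxy]
  exact (holds_res hR h x (hb z ε)).2 hx

end

end StoneSpace

end CompleteOrthomodularLattice

/-! # Commutative AW*-algebras of continuous functions -/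

/-- The structure of a commutative C*-algebra transported along a bijection. -/
@[reducible] noncomputable def Equiv.commCStarAlgebra {α β : Type u} [CommCStarAlgebra β] (e : α ≃ β) :
    CommCStarAlgebra α :=
  letI : CommRing α := e.commRing
  letI : NormedCommRing α := NormedCommRing.induced α β e.ringEquiv e.injective
  letI : Algebra ℂ α := e.algebra ℂ
  letI : NormedAlgebra ℂ α := NormedAlgebra.induced ℂ α β (e.algEquiv ℂ)
  have hmul (x y : α) : e (x * y) = e x * e y := e.apply_symm_apply _
  have hadd (x y : α) : e (x + y) = e x + e y := e.apply_symm_apply _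
  letI : Star α := ⟨fun a => e.symm (star (e a))⟩
  have hstar (x : α) : e (star x) = star (e x) := e.apply_symm_apply _
  letI : StarRing α :=
    { star_involutive := fun x => e.injective (by simp only [hstar, star_star])
      star_mul := fun x y => e.injective (by simp only [hstar, hmul, star_mul])
      star_add := fun x y => e.injective (by simp only [hstar, hadd, star_add]) }
  { star_smul := fun z x => e.injective (by
      have hsmul (z : ℂ) (x : α) : e (z • x) = z • e x := e.apply_symm_apply _
      simp only [hstar, hsmul, star_smul])
    norm_mul_self_le := fun x => by
      change ‖e x‖ * ‖e x‖ ≤ ‖e (star x * x)‖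
      rw [hmul, hstar, CStarRing.norm_star_mul_self]
    toCompleteSpace := by
      have h : Isometry e := AddMonoidHomClass.isometry_of_norm e.ringEquiv fun _ => rfl
      exact (h.isUniformInducing.completeSpace_congr e.surjective).2 inferInstance }

/-- The bijection along which the structure is transported is an isomorphism. -/
noncomputable def Equiv.starAlgEquiv {α β : Type u} [CommCStarAlgebra β] (e : α ≃ β) :
    letI := e.commCStarAlgebra
    α ≃⋆ₐ[ℂ] β :=
  letI := e.commCStarAlgebra
  { e with
    map_mul' := fun _ _ => e.apply_symm_apply _
    map_add' := fun _ _ => e.apply_symm_apply _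
    map_smul' := fun _ _ => e.apply_symm_apply _
    map_star' := fun _ => e.apply_symm_apply _ }

/-- Being an AW*-algebra is invariant under isomorphism. -/
theorem IsAWStarAlgebra.of_equiv {C D : Type u} [CStarAlgebra C] [CStarAlgebra D]
    (hD : IsAWStarAlgebra D) (e : C ≃⋆ₐ[ℂ] D) : IsAWStarAlgebra C := by
  intro S
  obtain ⟨p, hp, h⟩ := hD (e '' S)
  refine ⟨e.symm p, hp.map e.symm, ?_⟩
  ext y
  have h1 : y ∈ {y : C | ∀ x ∈ S, x * y = 0} ↔ e y ∈ {y : D | ∀ x ∈ e '' S, x * y = 0} := by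
    simp [← map_mul]
  rw [h1, h]
  constructor
  · rintro ⟨z, hz⟩
    exact ⟨e.symm z, EquivLike.injective e (by
      rw [hz, map_mul, e.apply_symm_apply, e.apply_symm_apply])⟩
  · rintro ⟨z, rfl⟩
    exact ⟨e z, by simp⟩

namespace CompleteOrthomodularLattice

namespace StoneSpace

variable {P : Type u} [CompleteOrthomodularLattice P] {R : Set P}

/-- The indicator function of an element of the Boolean subset. -/
def indicator (R : Set P) (p : P) : C(StoneSpace R, ℂ) where
  toFun x := if x.1 p then 1 else 0
  continuous_toFun := (continuous_of_discreteTopology (f := fun b : Bool => if b then (1 : ℂ) else 0)).comp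
    ((continuous_apply p).comp continuous_subtype_val)

theorem indicator_of_holds {p : P} {x : StoneSpace R} (h : x.holds p) : indicator R p x = 1 :=
  if_pos h

theorem indicator_of_not_holds {p : P} {x : StoneSpace R} (h : ¬ x.holds p) :
    indicator R p x = 0 := if_neg h

theorem isStarProjection_indicator (p : P) : IsStarProjection (indicator R p) where
  isIdempotentElem := by
    ext x
    by_cases h : x.holds p
    · simp [indicator_of_holds h]
    · simp [indicator_of_not_holds h]
  isSelfAdjoint := by
    ext x
    by_cases h : x.holds p
    · simp [indicator_of_holds h]
    · simp [indicator_of_not_holds h]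

theorem indicator_comp_res (hR : IsBooleanSubset R) {R' : Set P} (h : R ⊆ R') {p : P} (hp : p ∈ R) :
    (indicator R p).comp (res hR h) = indicator R' p := by
  ext x
  by_cases hx : x.holds p
  · rw [indicator_of_holds hx]
    exact indicator_of_holds ((holds_res hR h x hp).2 hx)
  · rw [indicator_of_not_holds hx]
    exact indicator_of_not_holds fun h' => hx ((holds_res hR h x hp).1 h')

theorem indicator_mul_eq_left_iff {f : C(StoneSpace R, ℂ)} {p : P} :
    f * indicator R p = f ↔ ∀ x, f x ≠ 0 → x.holds p := by
  constructor
  · intro h x hx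
    by_contra hp
    have := congrArg (fun g : C(StoneSpace R, ℂ) => g x) h
    simp only [ContinuousMap.mul_apply, indicator_of_not_holds hp, mul_zero] at this
    exact hx this.symm
  · intro h
    ext x
    by_cases hx : f x = 0
    · simp [hx]
    · simp [indicator_of_holds (h x hx)]

theorem one_sub_indicator {p : P} (hp : p ∈ R) : 1 - indicator R p = indicator R pᶜ := by
  ext x
  by_cases hx : x.holds p
  · rw [indicator_of_not_holds fun h => (x.holds_compl hp).1 h hx]
    simp [indicator_of_holds hx]
  · rw [indicator_of_holds ((x.holds_compl hp).2 hx)]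
    simp [indicator_of_not_holds hx]

section

variable (hR : IsBooleanSubset R)

include hR

/-- A projection takes only the values `0` and `1`, and the radius `1 / 2` separates these even for
the closed ball around `1`. -/
theorem eq_indicator_of_isStarProjection {f : C(StoneSpace R, ℂ)} (hf : IsStarProjection f) :
    f = indicator R (spec f 1 (1 / 2)) := by
  ext x
  have h1 : f x * f x = f x := congrArg (fun g : C(StoneSpace R, ℂ) => g x) hf.isIdempotentElem
  by_cases hx : x.holds (spec f 1 (1 / 2))
  · rw [indicator_of_holds hx]
    have h2 := dist_le_of_holds_spec hR hx
    have h0 : f x ≠ 0 := fun h0 => by rw [h0] at h2; norm_num at h2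
    exact mul_left_cancel₀ h0 (by rw [h1, mul_one])
  · rw [indicator_of_not_holds hx]
    by_contra h0
    have : f x = 1 := mul_left_cancel₀ h0 (by rw [h1, mul_one])
    exact hx (holds_spec hR (by rw [this, dist_self]; norm_num))

theorem spec_indicator {p : P} (hp : p ∈ R) : spec (indicator R p) 1 (1 / 2) = p := by
  refine le_antisymm ?_ ?_
  · refine clopenHull_le hR hp fun x hx => ?_
    by_contra h
    rw [Set.mem_preimage, indicator_of_not_holds h] at hx
    norm_num at hx
  · refine le_of_forall_holds hR hp (spec_mem hR _ _ _) fun x hx => holds_spec hR ?_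
    rw [indicator_of_holds hx, dist_self]
    norm_num

theorem indicator_eq_mul_iff {p q : P} (hp : p ∈ R) (hq : q ∈ R) :
    indicator R p = indicator R p * indicator R q ↔ p ≤ q := by
  rw [eq_comm, indicator_mul_eq_left_iff]
  constructor
  · intro h
    refine le_of_forall_holds hR hp hq fun x hx => h x ?_
    rw [indicator_of_holds hx]
    exact one_ne_zero
  · intro h x hx
    refine x.holds_mono hp hq h ?_
    by_contra hx'
    exact hx (indicator_of_not_holds hx')

/-- The continuous functions on the Stone space of a Boolean subset form an AW*-algebra. -/
theorem isAWStarAlgebra : IsAWStarAlgebra C(StoneSpace R, ℂ) := by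
  intro S
  -- The annihilator consists of the functions vanishing on `U`, equivalently on its closure. The
  -- latter is clopen, and the indicator of its complement generates.
  let U : Set (StoneSpace R) := {x | ∃ f ∈ S, f x ≠ 0}
  have hU : IsOpen U := by
    have : U = ⋃ f ∈ S, {x | f x ≠ 0} := by ext; simp [U]
    rw [this]
    exact isOpen_biUnion fun f _ => isOpen_ne_fun f.continuous continuous_const
  have hmem := clopenHull_mem hR U
  refine ⟨indicator R (clopenHull U)ᶜ, isStarProjection_indicator _, ?_⟩
  ext y
  constructor
  · intro hy
    refine ⟨y, ?_⟩
    rw [mul_comm, eq_comm, indicator_mul_eq_left_iff]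
    intro x hx
    rw [x.holds_compl hmem]
    refine not_holds_clopenHull hR (V := {x | y x ≠ 0})
      (isOpen_ne_fun y.continuous continuous_const) ?_ hx
    rw [Set.disjoint_left]
    rintro z ⟨f, hf, hfz⟩ hyz
    have := congrArg (fun g : C(StoneSpace R, ℂ) => g z) (hy f hf)
    exact (mul_ne_zero hfz hyz) this
  · rintro ⟨z, rfl⟩ f hf
    ext x
    by_cases hx : f x = 0
    · simp [hx]
    · have h1 := holds_clopenHull hR hU (x := x) ⟨f, hf, hx⟩
      simp [indicator_of_not_holds fun h => (x.holds_compl hmem).1 h h1]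

end

end StoneSpace

end CompleteOrthomodularLattice

/-! # The piecewise AW*-algebra of a complete orthomodular lattice -/

namespace CompleteOrthomodularLattice

open StoneSpace

/-- The bounded complex observables of a complete orthomodular lattice: the spectral families of
continuous functions on Stone spaces of Boolean subsets. -/
def Observable (P : Type u) [CompleteOrthomodularLattice P] : Type u :=
  {E : ℂ → ℝ → P // ∃ R : Set P, IsBooleanSubset R ∧ ∃ a : C(StoneSpace R, ℂ), spec a = E}

namespace Observable

variable {P : Type u} [CompleteOrthomodularLattice P]

/-- The values of the spectral family. -/
def values (E : Observable P) : Set P := {p | ∃ z ε, E.1 z ε = p}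

theorem apply_mem_values (E : Observable P) (z : ℂ) (ε : ℝ) : E.1 z ε ∈ E.values := ⟨z, ε, rfl⟩

/-- Observables are commeasurable when their spectral families commute. -/
def Comm (E F : Observable P) : Prop := ∀ p ∈ E.values, ∀ q ∈ F.values, Commutes p q

theorem comm_self (E : Observable P) : Comm E E := by
  obtain ⟨R, hR, a, ha⟩ := E.2
  rintro _ ⟨z, ε, rfl⟩ _ ⟨w, δ, rfl⟩
  rw [← ha]
  exact hR.commutes _ (spec_mem hR a _ _) _ (spec_mem hR a _ _)

theorem Comm.symm {E F : Observable P} (h : Comm E F) : Comm F E :=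
  fun p hp q hq => (h q hq p hp).symm

/-- The Boolean subset generated by the values of a set of observables. -/
def gen (S : Set (Observable P)) : Set P := commutant (commutant (⋃ E ∈ S, E.values))

theorem isBooleanSubset_gen {S : Set (Observable P)} (hS : PairwiseRel Comm S) :
    IsBooleanSubset (gen S) := by
  refine isBooleanSubset_bicommutant ?_
  intro p hp q hq
  obtain ⟨E, hE, hp⟩ := Set.mem_iUnion₂.1 hp
  obtain ⟨F, hF, hq⟩ := Set.mem_iUnion₂.1 hq
  exact hS E hE F hF p hp q hq

theorem values_subset_gen {S : Set (Observable P)} {E : Observable P} (hE : E ∈ S) :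
    E.values ⊆ gen S :=
  (Set.subset_biUnion_of_mem (u := fun E : Observable P => E.values) hE).trans
    (subset_bicommutant _)

theorem gen_mono {S S' : Set (Observable P)} (h : S ⊆ S') : gen S ⊆ gen S' :=
  commutant_anti (commutant_anti (Set.biUnion_subset_biUnion_left h))

theorem gen_subset {S : Set (Observable P)} {R : Set P} (hR : IsBooleanSubset R)
    (h : ∀ E ∈ S, E.values ⊆ R) : gen S ⊆ R :=
  (commutant_anti (commutant_anti (Set.iUnion₂_subset h))).trans hR.bicommutant_subset

variable {R : Set P}

/-- The observable of a continuous function. -/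
def ofFun (hR : IsBooleanSubset R) (a : C(StoneSpace R, ℂ)) : Observable P :=
  ⟨spec a, R, hR, a, rfl⟩

theorem values_ofFun_subset (hR : IsBooleanSubset R) (a : C(StoneSpace R, ℂ)) :
    (ofFun hR a).values ⊆ R := by
  rintro _ ⟨z, ε, rfl⟩
  exact spec_mem hR a z ε

theorem ofFun_injective (hR : IsBooleanSubset R) : Function.Injective (ofFun hR) :=
  fun _ _ h => spec_injective hR (congrArg Subtype.val h)

theorem ofFun_comp_res (hR : IsBooleanSubset R) {R' : Set P} (hR' : IsBooleanSubset R')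
    (h : R ⊆ R') (a : C(StoneSpace R, ℂ)) : ofFun hR' (a.comp (res hR h)) = ofFun hR a :=
  Subtype.ext (spec_comp_res hR hR' h a)

theorem pairwise_singleton (E : Observable P) : PairwiseRel Comm {E} := by
  rintro _ rfl _ rfl
  exact comm_self _

/-- The Boolean subset generated by the values of `E` lies in both `R₀` and `R`. The function on the
Stone space of `R₀` descends to it and is then pulled back to that of `R`. -/
theorem exists_ofFun_eq (E : Observable P) (hR : IsBooleanSubset R) (h : E.values ⊆ R) :
    ∃ a : C(StoneSpace R, ℂ), ofFun hR a = E := by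
  obtain ⟨R₀, hR₀, b, hb⟩ := E.2
  have hb' : ofFun hR₀ b = E := Subtype.ext hb
  have hG := isBooleanSubset_gen (pairwise_singleton E)
  have h0 : gen {E} ⊆ R₀ := gen_subset hR₀ (by
    rintro _ rfl; rw [← hb']; exact values_ofFun_subset hR₀ b)
  have h1 : gen {E} ⊆ R := gen_subset hR (by rintro _ rfl; exact h)
  obtain ⟨a, ha⟩ := exists_comp_res hG hR₀ h0 b fun z ε =>
    values_subset_gen (Set.mem_singleton E) (hb ▸ E.apply_mem_values z ε)
  refine ⟨a.comp (res hG h1), (ofFun_comp_res hG hR h1 a).trans ?_⟩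
  rw [← ofFun_comp_res hG hR₀ h0, ha, hb']

/-- The continuous function on a Stone space representing an observable. -/
noncomputable def rep (E : Observable P) (hR : IsBooleanSubset R) (h : E.values ⊆ R) :
    C(StoneSpace R, ℂ) := (E.exists_ofFun_eq hR h).choose

theorem ofFun_rep (E : Observable P) (hR : IsBooleanSubset R) (h : E.values ⊆ R) :
    ofFun hR (E.rep hR h) = E := (E.exists_ofFun_eq hR h).choose_spec

theorem rep_eq_of_ofFun_eq {E : Observable P} (hR : IsBooleanSubset R) (h : E.values ⊆ R)
    {a : C(StoneSpace R, ℂ)} (ha : ofFun hR a = E) : E.rep hR h = a :=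
  ofFun_injective hR ((E.ofFun_rep hR h).trans ha.symm)

theorem rep_ofFun (hR : IsBooleanSubset R) (a : C(StoneSpace R, ℂ)) :
    (ofFun hR a).rep hR (values_ofFun_subset hR a) = a := rep_eq_of_ofFun_eq hR _ rfl

theorem rep_comp_res (E : Observable P) (hR : IsBooleanSubset R) {R' : Set P}
    (hR' : IsBooleanSubset R') (h : R ⊆ R') (hE : E.values ⊆ R) :
    (E.rep hR hE).comp (res hR h) = E.rep hR' (hE.trans h) :=
  (rep_eq_of_ofFun_eq hR' _ (by rw [ofFun_comp_res, ofFun_rep])).symm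

/-- A Boolean subset identifies the observables with values in it with continuous functions. -/
noncomputable def equiv (hR : IsBooleanSubset R) :
    ({E | E.values ⊆ R} : Set (Observable P)) ≃ C(StoneSpace R, ℂ) where
  toFun E := E.1.rep hR E.2
  invFun a := ⟨ofFun hR a, values_ofFun_subset hR a⟩
  left_inv E := Subtype.ext (E.1.ofFun_rep hR E.2)
  right_inv a := rep_ofFun hR a

theorem ofFun_equiv (hR : IsBooleanSubset R) (E : ({E | E.values ⊆ R} : Set (Observable P))) :
    ofFun hR (equiv hR E) = E.1 := E.1.ofFun_rep hR E.2

/-! ### Operations -/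

theorem pairwise_pair {E F : Observable P} (h : Comm E F) : PairwiseRel Comm {E, F} := by
  rintro _ (rfl | rfl) _ (rfl | rfl)
  exacts [comm_self _, h, h.symm, comm_self _]

/-- Composition of a continuous operation with continuous functions. -/
noncomputable def applyOp {X : Type u} [TopologicalSpace X] (op : C(ℂ × ℂ, ℂ)) (a b : C(X, ℂ)) : C(X, ℂ) :=
  op.comp (a.prodMk b)

/-- A continuous operation on commeasurable observables. -/
noncomputable def combine (op : C(ℂ × ℂ, ℂ)) (E F : Observable P) (h : Comm E F) : Observable P :=
  ofFun (isBooleanSubset_gen (pairwise_pair h))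
    (applyOp op (E.rep (isBooleanSubset_gen (pairwise_pair h)) (values_subset_gen (by simp)))
      (F.rep (isBooleanSubset_gen (pairwise_pair h)) (values_subset_gen (by simp))))

/-- Pointwise operations commute with pullback along restrictions, so any Boolean subset containing
the values may be used. -/
theorem combine_eq (op : C(ℂ × ℂ, ℂ)) {E F : Observable P} (h : Comm E F)
    (hR : IsBooleanSubset R) (hE : E.values ⊆ R) (hF : F.values ⊆ R) :
    combine op E F h = ofFun hR (applyOp op (E.rep hR hE) (F.rep hR hF)) := by
  have hs : gen {E, F} ⊆ R := gen_subset hR (by rintro _ (rfl | rfl) <;> assumption)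
  have hG := isBooleanSubset_gen (pairwise_pair h)
  rw [← E.rep_comp_res hG hR hs (values_subset_gen (by simp)),
    ← F.rep_comp_res hG hR hs (values_subset_gen (by simp))]
  exact (ofFun_comp_res hG hR hs _).symm

theorem isBooleanSubset_gen_empty : IsBooleanSubset (gen (∅ : Set (Observable P))) :=
  isBooleanSubset_gen fun _ h => h.elim

variable (P) in
/-- A constant observable. -/
noncomputable def const (z : ℂ) : Observable P := ofFun isBooleanSubset_gen_empty (ContinuousMap.const _ z)

theorem const_eq (z : ℂ) (hR : IsBooleanSubset R) :
    const P z = ofFun hR (ContinuousMap.const _ z) :=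
  (ofFun_comp_res _ hR (gen_subset hR fun _ h => h.elim) _).symm

/-- The norm of an observable. -/
noncomputable def norm (E : Observable P) : ℝ :=
  ‖E.rep (isBooleanSubset_gen (pairwise_singleton E)) (values_subset_gen rfl)‖

/-- Restriction of points is surjective, so pullback preserves the supremum norm. -/
theorem norm_rep (E : Observable P) (hR : IsBooleanSubset R) (h : E.values ⊆ R) :
    ‖E.rep hR h‖ = E.norm := by
  have hG := isBooleanSubset_gen (pairwise_singleton E)
  have hs : gen {E} ⊆ R := gen_subset hR (by rintro _ rfl; exact h)
  rw [← E.rep_comp_res hG hR hs (values_subset_gen rfl), norm, ContinuousMap.norm_eq_iSup_norm,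
    ContinuousMap.norm_eq_iSup_norm]
  exact (res_surjective hG hR hs).iSup_comp
    (fun x => ‖E.rep hG (values_subset_gen rfl) x‖)

noncomputable instance : PCStarData (Observable P) where
  comm := Comm
  comm_refl := comm_self
  comm_symm _ _ h := h.symm
  zero := const P 0
  one := const P 1
  -- Unary operations are treated as binary ones on the pair of `E` with itself that ignore the
  -- second coordinate.
  star E := combine ⟨fun z => star z.1, by fun_prop⟩ E E E.comm_self
  smul z E := combine ⟨fun w => z * w.1, by fun_prop⟩ E E E.comm_self
  norm := norm
  add E F h := combine ⟨fun z => z.1 + z.2, by fun_prop⟩ E F h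
  mul E F h := combine ⟨fun z => z.1 * z.2, by fun_prop⟩ E F h

section

variable {E F : Observable P} (hR : IsBooleanSubset R) (hE : E.values ⊆ R) (hF : F.values ⊆ R)

theorem star_eq : PCStarData.star E = ofFun hR (star (E.rep hR hE)) :=
  (combine_eq _ E.comm_self hR hE hE).trans (congrArg (ofFun hR) (by ext x; rfl))

theorem smul_eq (z : ℂ) : PCStarData.smul z E = ofFun hR (z • E.rep hR hE) :=
  (combine_eq _ E.comm_self hR hE hE).trans (congrArg (ofFun hR) (by ext x; rfl))

theorem add_eq (h : PCStarData.comm E F) :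
    PCStarData.add E F h = ofFun hR (E.rep hR hE + F.rep hR hF) :=
  (combine_eq _ h hR hE hF).trans (congrArg (ofFun hR) (by ext x; rfl))

theorem mul_eq (h : PCStarData.comm E F) :
    PCStarData.mul E F h = ofFun hR (E.rep hR hE * F.rep hR hF) :=
  (combine_eq _ h hR hE hF).trans (congrArg (ofFun hR) (by ext x; rfl))

end

/-- The commutative C*-algebra of observables with values in a Boolean subset. -/
noncomputable def subalgebra (hR : IsBooleanSubset R) :
    CommeasurableCStarSubalgebra ({E | E.values ⊆ R} : Set (Observable P)) where
  pairwise_comm _ hE _ hF p hp q hq := hR.commutes p (hE hp) q (hF hq)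
  alg := (equiv hR).commCStarAlgebra
  coe_zero := (const_eq 0 hR).symm
  coe_one := (const_eq 1 hR).symm
  coe_star E := (star_eq hR E.2).symm
  coe_smul z E := (smul_eq hR E.2 z).symm
  coe_norm E := E.1.norm_rep hR E.2
  coe_add E F h := (add_eq hR E.2 F.2 h).symm
  coe_mul E F h := (mul_eq hR E.2 F.2 h).symm

noncomputable instance : PiecewiseCStarAlgebra (Observable P) where
  exists_subalgebra _ hS :=
    ⟨_, fun _ hE => values_subset_gen hE, ⟨subalgebra (isBooleanSubset_gen hS)⟩⟩

end Observable

end CompleteOrthomodularLattice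

namespace CompleteOrthomodularLattice

open StoneSpace

namespace Observable

variable {P : Type u} [CompleteOrthomodularLattice P] {R : Set P}

/-! ### Projections -/

theorem isStarProjection_rep (p : PProj (Observable P)) (hR : IsBooleanSubset R)
    (h : p.1.values ⊆ R) : IsStarProjection (p.1.rep hR h) where
  isIdempotentElem := ofFun_injective hR (by
    rw [← mul_eq hR h h (PCStarData.comm_refl _), ofFun_rep]; exact p.2.2)
  isSelfAdjoint := ofFun_injective hR (by
    rw [← star_eq hR h, ofFun_rep]; exact p.2.1)

/-- The element of the lattice corresponding to a projection. -/
noncomputable def toElem (p : PProj (Observable P)) : P := p.1.1 1 (1 / 2)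

theorem toElem_mem_values (p : PProj (Observable P)) : toElem p ∈ p.1.values := ⟨_, _, rfl⟩

theorem rep_eq_indicator (p : PProj (Observable P)) (hR : IsBooleanSubset R)
    (h : p.1.values ⊆ R) : p.1.rep hR h = indicator R (toElem p) := by
  conv_lhs => rw [eq_indicator_of_isStarProjection hR (isStarProjection_rep p hR h)]
  congr 1
  exact congrFun (congrFun (congrArg Subtype.val (p.1.ofFun_rep hR h)) 1) (1 / 2)

theorem pairwise_singleton_commutes (q : P) : ∀ p ∈ ({q} : Set P), ∀ r ∈ ({q} : Set P),
    Commutes p r := by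
  rintro _ rfl _ rfl
  exact commutes_refl _

/-- The projection corresponding to an element of the lattice. -/
noncomputable def ofElem (q : P) : PProj (Observable P) :=
  have hR := isBooleanSubset_bicommutant (pairwise_singleton_commutes q)
  have h := isStarProjection_indicator (R := commutant (commutant {q})) q
  ⟨ofFun hR (indicator _ q),
    (star_eq hR (values_ofFun_subset hR _)).trans (congrArg (ofFun hR) (by
      rw [rep_ofFun]; exact h.isSelfAdjoint)),
    (mul_eq hR (values_ofFun_subset hR _) (values_ofFun_subset hR _) _).trans
      (congrArg (ofFun hR) (by rw [rep_ofFun]; exact h.isIdempotentElem))⟩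

theorem ofElem_eq {q : P} (hR : IsBooleanSubset R) (hq : q ∈ R) :
    (ofElem q).1 = ofFun hR (indicator R q) := by
  have hS := isBooleanSubset_bicommutant (pairwise_singleton_commutes q)
  have h : commutant (commutant {q}) ⊆ R :=
    (commutant_anti (commutant_anti (by simpa using hq))).trans hR.bicommutant_subset
  rw [← indicator_comp_res hS h (subset_bicommutant _ rfl), ofFun_comp_res]
  rfl

theorem toElem_ofElem (q : P) : toElem (ofElem q) = q :=
  spec_indicator (isBooleanSubset_bicommutant (pairwise_singleton_commutes q))
    (subset_bicommutant _ rfl)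

theorem toElem_injective : Function.Injective (toElem : PProj (Observable P) → P) := by
  intro p q h
  refine Subtype.ext ?_
  have hp := isBooleanSubset_gen (pairwise_singleton p.1)
  have hp' : p.1.values ⊆ gen {p.1} := values_subset_gen rfl
  have hq := isBooleanSubset_gen (pairwise_singleton q.1)
  have hq' : q.1.values ⊆ gen {q.1} := values_subset_gen rfl
  rw [← p.1.ofFun_rep hp hp', ← q.1.ofFun_rep hq hq', rep_eq_indicator, rep_eq_indicator,
    ← ofElem_eq hp (hp' (toElem_mem_values p)), ← ofElem_eq hq (hq' (toElem_mem_values q)), h]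

theorem ofElem_toElem (p : PProj (Observable P)) : ofElem (toElem p) = p :=
  toElem_injective (toElem_ofElem _)

theorem values_subset_iff (p : PProj (Observable P)) (hR : IsBooleanSubset R) :
    p.1.values ⊆ R ↔ toElem p ∈ R := by
  refine ⟨fun h => h (toElem_mem_values p), fun h => ?_⟩
  rw [← ofElem_toElem p, ofElem_eq hR h]
  exact values_ofFun_subset hR _

theorem comm_iff (p q : PProj (Observable P)) :
    PProj.comm p q ↔ Commutes (toElem p) (toElem q) := by
  refine ⟨fun h => h _ (toElem_mem_values p) _ (toElem_mem_values q), fun h => ?_⟩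
  have hR : IsBooleanSubset (commutant (commutant {toElem p, toElem q})) := by
    refine isBooleanSubset_bicommutant ?_
    rintro _ (rfl | rfl) _ (rfl | rfl)
    exacts [commutes_refl _, h, h.symm, commutes_refl _]
  intro a ha b hb
  exact hR.commutes a ((values_subset_iff p hR).2 (subset_bicommutant _ (by simp)) ha)
    b ((values_subset_iff q hR).2 (subset_bicommutant _ (by simp)) hb)

/-- The support of an observable: where it does not vanish. -/
def support (E : Observable P) : P := sSup {p | ∃ z ε, ε < ‖z‖ ∧ E.1 z ε = p}

theorem support_mem {E : Observable P} (hR : IsBooleanSubset R) (h : E.values ⊆ R) :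
    E.support ∈ R :=
  hR.sSup_mem (by rintro _ ⟨z, ε, _, rfl⟩; exact h ⟨z, ε, rfl⟩)

/-- The condition `ε < ‖z‖` keeps the closed ball away from `0`, so these spectral values hold only
where the function is nonzero. Conversely, near a value `w ≠ 0` the ball of radius `‖w‖ / 2` about
`w` qualifies. -/
theorem support_le_iff {E : Observable P} (hR : IsBooleanSubset R) (h : E.values ⊆ R) {q : P}
    (hq : q ∈ R) : E.support ≤ q ↔ E.rep hR h * indicator R q = E.rep hR h := by
  rw [indicator_mul_eq_left_iff]
  have hs (z : ℂ) (ε : ℝ) : E.1 z ε = spec (E.rep hR h) z ε :=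
    congrFun (congrFun (congrArg Subtype.val (E.ofFun_rep hR h).symm) z) ε
  constructor
  · intro hle x hx
    refine x.holds_mono (spec_mem hR (E.rep hR h) (E.rep hR h x) (‖E.rep hR h x‖ / 2)) hq
      (le_trans ?_ hle) (holds_spec hR ?_)
    · exact le_sSup ⟨_, _, half_lt_self (norm_pos_iff.2 hx), hs _ _⟩
    · rw [dist_self]; have := norm_pos_iff.2 hx; positivity
  · intro hx
    refine sSup_le ?_
    rintro _ ⟨z, ε, hz, rfl⟩
    rw [hs]
    refine le_of_forall_holds hR (spec_mem hR _ _ _) hq fun x hxs => hx x fun h0 => ?_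
    have := dist_le_of_holds_spec hR hxs
    rw [h0, dist_zero_left] at this
    exact absurd this (not_le.2 hz)

noncomputable instance : PAWStarData (Observable P) where
  rp E := ofElem E.support
  sup X _ := ofElem (sSup (toElem '' X))

section

variable (hR : IsBooleanSubset R)

theorem isStarProjection_iff (p : ({E | E.values ⊆ R} : Set (Observable P))) :
    letI := (equiv hR).commCStarAlgebra
    IsStarProjection p ↔ ∃ q ∈ R, equiv hR p = indicator R q := by
  let _ := (equiv hR).commCStarAlgebra
  let e := (equiv hR).starAlgEquiv
  constructor
  · intro h
    exact ⟨_, spec_mem hR _ _ _, eq_indicator_of_isStarProjection hR (h.map e)⟩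
  · rintro ⟨q, _, hq⟩
    have h1 : IsStarProjection (e p) := by
      have := isStarProjection_indicator (R := R) q
      rw [← hq] at this
      exact this
    have := h1.map e.symm
    rwa [e.symm_apply_apply] at this

theorem eq_mul_iff (p q : ({E | E.values ⊆ R} : Set (Observable P))) :
    letI := (equiv hR).commCStarAlgebra
    p = p * q ↔ equiv hR p = equiv hR p * equiv hR q := by
  let _ := (equiv hR).commCStarAlgebra
  rw [← (equiv hR).injective.eq_iff]
  exact Eq.congr_right (map_mul (equiv hR).starAlgEquiv p q)

/-- The commutative AW*-algebra of observables with values in a Boolean subset. -/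
noncomputable def awStarSubalgebra :
    CommeasurableAWStarSubalgebra ({E | E.values ⊆ R} : Set (Observable P)) where
  toCommeasurableCStarSubalgebra := subalgebra hR
  isAWStar :=
    letI := (equiv hR).commCStarAlgebra
    (StoneSpace.isAWStarAlgebra hR).of_equiv (equiv hR).starAlgEquiv
  rp_spec a := by
    let _ := (equiv hR).commCStarAlgebra
    have hmem := support_mem hR a.2
    have hv : (ofElem a.1.support).1.values ⊆ R :=
      (values_subset_iff _ hR).2 (by rwa [toElem_ofElem])
    have hp : equiv hR ⟨_, hv⟩ = indicator R a.1.support := by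
      refine (rep_eq_indicator _ hR hv).trans ?_
      rw [toElem_ofElem]
    refine ⟨⟨_, hv⟩, rfl, (isStarProjection_iff hR _).2 ⟨_, hmem, hp⟩, ?_, fun q hq haq => ?_⟩
    · refine ((eq_mul_iff hR _ _).2 ?_).symm
      rw [hp]
      exact ((support_le_iff hR a.2 hmem).1 le_rfl).symm
    · obtain ⟨r, hr, hqr⟩ := (isStarProjection_iff hR q).1 hq
      have h1 := (eq_mul_iff hR _ _).1 haq.symm
      refine (eq_mul_iff hR _ _).2 ?_
      rw [hp, hqr, indicator_eq_mul_iff hR hmem hr, support_le_iff hR a.2 hr]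
      rw [hqr] at h1
      exact h1.symm
  sup_spec X hX h := by
    let _ := (equiv hR).commCStarAlgebra
    have hX' (x : PProj (Observable P)) (hx : x ∈ X) : toElem x ∈ R :=
      (values_subset_iff x hR).1 (h x hx)
    have hmem : sSup (toElem '' X) ∈ R := hR.sSup_mem (by
      rintro _ ⟨x, hx, rfl⟩; exact hX' x hx)
    have hv : (ofElem (sSup (toElem '' X))).1.values ⊆ R :=
      (values_subset_iff _ hR).2 (by rwa [toElem_ofElem])
    have hp : equiv hR ⟨_, hv⟩ = indicator R (sSup (toElem '' X)) := by
      refine (rep_eq_indicator _ hR hv).trans ?_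
      rw [toElem_ofElem]
    have hx (x : PProj (Observable P)) (hx : x ∈ X) :
        equiv hR ⟨x.1, h x hx⟩ = indicator R (toElem x) := rep_eq_indicator x hR (h x hx)
    refine ⟨⟨_, hv⟩, rfl, (isStarProjection_iff hR _).2 ⟨_, hmem, hp⟩, ?_, fun q hq haq => ?_⟩
    · rintro ⟨_, hp'⟩ ⟨x, hxX, rfl⟩
      refine (eq_mul_iff hR _ _).2 ?_
      rw [hx x hxX, hp, indicator_eq_mul_iff hR (hX' x hxX) hmem]
      exact le_sSup ⟨x, hxX, rfl⟩
    · obtain ⟨r, hr, hqr⟩ := (isStarProjection_iff hR q).1 hq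
      refine (eq_mul_iff hR _ _).2 ?_
      rw [hp, hqr, indicator_eq_mul_iff hR hmem hr]
      refine sSup_le ?_
      rintro _ ⟨x, hxX, rfl⟩
      have h1 := (eq_mul_iff hR _ _).1 (haq ⟨x.1, h x hxX⟩ ⟨x, hxX, rfl⟩)
      rwa [hx x hxX, hqr, indicator_eq_mul_iff hR (hX' x hxX) hr] at h1

end

/-- Coherence holds because bicommutants are monotone. -/
noncomputable instance : PiecewiseAWStarAlgebra (Observable P) where
  exists_subalgebra_mono :=
    ⟨fun S _ => {E | E.values ⊆ gen S}, fun _ _ _ hE => values_subset_gen hE,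
      fun _ hS => ⟨awStarSubalgebra (isBooleanSubset_gen hS)⟩,
      fun _ _ _ _ h _ hE => hE.trans (gen_mono h)⟩

/-- The projections of the algebra of observables are the elements of the lattice. -/
noncomputable def projEquiv : PProj (Observable P) ≃ P where
  toFun := toElem
  invFun := ofElem
  left_inv := ofElem_toElem
  right_inv := toElem_ofElem

theorem toElem_neg (p : PProj (Observable P)) : toElem p.neg = (toElem p)ᶜ := by
  have hR := isBooleanSubset_gen (pairwise_singleton p.1)
  have hp : p.1.values ⊆ gen {p.1} := values_subset_gen rfl
  have ht := hp (toElem_mem_values p)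
  let _ := (equiv hR).commCStarAlgebra
  have h := (subalgebra hR).coe_oneSub ⟨p.1, hp⟩
  have h1 : p.neg.1 = ofFun hR (equiv hR (1 - ⟨p.1, hp⟩)) := by
    rw [ofFun_equiv]; exact h.symm
  have h2 : equiv hR (1 - ⟨p.1, hp⟩) = 1 - equiv hR ⟨p.1, hp⟩ := by
    have := map_sub (equiv hR).starAlgEquiv 1 ⟨p.1, hp⟩
    rw [map_one] at this
    exact this
  have h3 : equiv hR ⟨p.1, hp⟩ = indicator _ (toElem p) := rep_eq_indicator p hR hp
  rw [h2, h3, one_sub_indicator ht, ← ofElem_eq hR (hR.compl_mem ht)] at h1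
  rw [show p.neg = ofElem _ from Subtype.ext h1, toElem_ofElem]

theorem toElem_sup {X : Set (PProj (Observable P))} (hX : PairwiseRel PCBData.comm X) :
    toElem (PCBData.sup X hX) = sSup (toElem '' X) := toElem_ofElem _

theorem inducedLE_iff_toElem_le {p q : PProj (Observable P)} :
    inducedLE p q ↔ toElem p ≤ toElem q := by
  rw [PiecewiseCBA.le_iff]
  constructor
  · rintro ⟨h, e⟩
    rw [← e, toElem_sup]
    exact le_sSup ⟨p, by simp, rfl⟩
  · intro h
    refine ⟨PiecewiseCBA.pairwiseRel_pair ((comm_iff p q).2 (commutes_of_le h)), ?_⟩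
    refine toElem_injective ?_
    rw [toElem_sup, Set.image_pair, sSup_pair, sup_eq_right.2 h]

variable (P) in
/-- The transitive joined piecewise AW*-algebra of a complete orthomodular lattice. -/
noncomputable def tjPAWStar : TJPAWStar.{u} where
  obj := ⟨Observable P⟩
  transitive _ _ _ h h' := inducedLE_iff_toElem_le.2
    ((inducedLE_iff_toElem_le.1 h).trans (inducedLE_iff_toElem_le.1 h'))
  joined p q := by
    refine ⟨ofElem (toElem p ⊔ toElem q), inducedLE_iff_toElem_le.2 ?_,
      inducedLE_iff_toElem_le.2 ?_, fun r h1 h2 => inducedLE_iff_toElem_le.2 ?_⟩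
    · rw [toElem_ofElem]; exact le_sup_left
    · rw [toElem_ofElem]; exact le_sup_right
    · rw [toElem_ofElem]
      exact sup_le (inducedLE_iff_toElem_le.1 h1) (inducedLE_iff_toElem_le.1 h2)

end Observable

end CompleteOrthomodularLattice

/-! ### The equivalences -/

open CompleteOrthomodularLattice

instance : projFunctor.{u}.EssSurj where
  mem_essImage B := by
    obtain ⟨P, ⟨e⟩⟩ := Functor.EssSurj.mem_essImage (F := comlToTJPCBoolean) B
    obtain ⟨e'⟩ : Nonempty (projFunctor.obj (Observable.tjPAWStar P.carrier) ≅
        comlToTJPCBoolean.obj P) :=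
      TJPCBoolean.nonempty_iso (B := (Observable.tjPAWStar P.carrier).proj) (C := P.toTJPCBoolean)
        Observable.projEquiv Observable.comm_iff Observable.toElem_neg
        fun _ hX _ => Observable.toElem_sup hX
    exact ⟨_, ⟨e' ≪≫ e⟩⟩

instance : projFunctor.{u}.IsEquivalence where

theorem mainTheorem9 :
    Nonempty (COML.{u} ≌ TJPCBoolean.{u}) ∧
    Nonempty (TJPCBoolean.{u} ≌ TJPAWStar.{u}) ∧
    Nonempty (COML.{u} ≌ TJPAWStar.{u}) :=
  ⟨⟨comlToTJPCBoolean.asEquivalence⟩, ⟨projFunctor.asEquivalence.symm⟩,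
    ⟨comlToTJPCBoolean.asEquivalence.trans projFunctor.asEquivalence.symm⟩⟩
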